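/- All graphs are finite; "graph" means simple graph. A \emph{1-factorisation} of a graph is a partition of its edge set into perfect matchings (1-factors), and a pair of distinct 1-factors in it is \emph{perfect} if their union is a hamiltonian cycle. A graph is \emph{quintic} if it is 5-regular. \textbf{Theorem.} There exists an infinite family of pairwise non-isomorphic planar 5-connected quintic graphs, each of which has a 1-factorisation, such that every 1-factorisation of every member of the family has zero perfect pairs. Moreover, the family can be chosen such that there are a non-hamiltonian, 3-connected, cyclically 5-edge-connected, planar cubic graph $H$ and a 1-factorisation $\{F_1,F_2,F_3\}$ of $H$ for which each member of the family arises as follows. Let $H_5$ be the 5-regular multigraph obtained from $H$ by replacing each edge of $F_1\cup F_2$ by a double edge. For some planar 5-connected quintic graph $G$ that has a 1-factorisation, and some vertex $g$ of $G$ (both depending on the member), replace each vertex $w$ of $H_5$ by a copy of $G-g$, and let the five edges of $H_5$ at $w$ be incident with the five vertices of this copy that correspond to the neighbours of $g$ in $G$, one edge at each. (Cyclically 5-edge-connected means that no set of fewer than five edges separates two cycles, i.e.\ after deleting such a set all remaining cycles lie in one component.) -/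

import Mathlib

namespace PerfectPairs

variable {V W U : Type*}

open Classical in
/-- Every vertex of the finite graph `G` has degree `d`. -/
def IsRegular [Fintype V] (G : SimpleGraph V) (d : ℕ) : Prop :=
  G.IsRegularOfDegree d

/-- `k`-(vertex-)connectedness: more than `k` vertices, and deleting fewer than `k` vertices
always leaves a connected graph. -/
def IsKConnected (G : SimpleGraph V) (k : ℕ) : Prop :=
  (k : ℕ∞) < ENat.card V ∧
    ∀ S : Set V, S.encard < k → (G.induce Sᶜ).Connected

/-- Cyclic `k`-edge-connectedness: deleting fewer than `k` edges never separates two cycles,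
that is, any two cycles that survive lie in the same component. -/
def IsCyclicallyKEdgeConnected (G : SimpleGraph V) (k : ℕ) : Prop :=
  ∀ S : Set (Sym2 V), S.encard < k →
    ∀ (u v : V) (p : (G.deleteEdges S).Walk u u) (q : (G.deleteEdges S).Walk v v),
      p.IsCycle → q.IsCycle → (G.deleteEdges S).Reachable u v

/-- The permutation of the darts (oriented edges) of `G` that reverses every dart. -/
def reversal (G : SimpleGraph V) : Equiv.Perm G.Dart :=
  Function.Involutive.toPerm SimpleGraph.Dart.symm SimpleGraph.Dart.symm_involutive

/-- A rotation system: `σ` permutes cyclically the darts that leave any given vertex. -/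
def IsRotationSystem (G : SimpleGraph V) (σ : Equiv.Perm G.Dart) : Prop :=
  ∀ d e : G.Dart, σ.SameCycle d e ↔ d.fst = e.fst

/-- The facial walks of the embedding described by the rotation system `σ`: the orbits of
"traverse the dart, then turn to the next dart at its head". An isolated vertex has no dart; the
single face of such a component is counted separately below. -/
abbrev Face (G : SimpleGraph V) (σ : Equiv.Perm G.Dart) : Type _ :=
  Quotient (Equiv.Perm.SameCycle.setoid (σ * reversal G))

/-- A finite graph is planar if it has an embedding (rotation system) of genus zero, that is,
one that satisfies Euler's formula, `#V - #E + #F = 2 * #components`, when every component is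
embedded in a sphere of its own. (Every component contributes at most `2`, so equality holds
exactly if each of them has genus zero.) -/
def IsPlanar [Finite V] (G : SimpleGraph V) : Prop :=
  ∃ σ : Equiv.Perm G.Dart, IsRotationSystem G σ ∧
    Nat.card V + (Nat.card (Face G σ) + Nat.card {v : V // ∀ w, ¬ G.Adj v w}) =
      Nat.card G.edgeSet + 2 * Nat.card G.ConnectedComponent

/-- A 1-factorisation: a set of 1-factors such that every edge lies in exactly one of them. -/
def IsOneFactorisation (G : SimpleGraph V) (𝓕 : Set G.Subgraph) : Prop :=
  (∀ M ∈ 𝓕, M.IsPerfectMatching) ∧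
    ∀ e ∈ G.edgeSet, ∃! M : G.Subgraph, M ∈ 𝓕 ∧ e ∈ M.edgeSet

/-- Two distinct 1-factors form a perfect pair if their union is a hamiltonian cycle. -/
def IsPerfectPair [DecidableEq V] {G : SimpleGraph V} (M N : G.Subgraph) : Prop :=
  M ≠ N ∧ ∃ (v : V) (p : G.Walk v v), p.IsHamiltonianCycle ∧ p.toSubgraph = M ⊔ N

open Classical in
/-- Edge multiplicities of the multigraph obtained from `H` by replacing every edge that is not
in `F` by a double edge. -/
noncomputable def doubledOutside (H : SimpleGraph W) (F : H.Subgraph) (u v : W) : ℕ :=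
  if F.Adj u v then 1 else if H.Adj u v then 2 else 0

/-- `Γ` arises by substituting a copy of `G - g` for each vertex of the multigraph on `W` with
edge multiplicities `m`: the vertex set of `Γ` is that of `W` many disjoint copies of `G - g`;
inside a copy the edges are those of `G - g`; exactly the neighbours of `g` keep an edge that
leaves their copy, one each; and the copies at `w ≠ w'` are joined by `m w w'` edges. -/
def IsSubstitution (m : W → W → ℕ) (G : SimpleGraph U) (g : U) (Γ : SimpleGraph V) : Prop :=
  ∃ e : W × {x : U // x ≠ g} ≃ V,
    (∀ w x y, Γ.Adj (e (w, x)) (e (w, y)) ↔ G.Adj x.1 y.1) ∧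
    (∀ w x, G.Adj g x.1 →
      ∃! q : W × {x : U // x ≠ g}, q.1 ≠ w ∧ Γ.Adj (e (w, x)) (e q)) ∧
    (∀ w x (q : W × {x : U // x ≠ g}), q.1 ≠ w → Γ.Adj (e (w, x)) (e q) → G.Adj g x.1) ∧
    (∀ w w', w ≠ w' →
      {z : {x : U // x ≠ g} × {x : U // x ≠ g} |
        Γ.Adj (e (w, z.1)) (e (w', z.2))}.encard = m w w')

end PerfectPairs

namespace PerfectPairs

open SimpleGraph

/-! Let `G` be a planar 5-connected quintic graph with a 1-factorisation, so that `G - g` has odd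
order. In a 1-factorisation of the substitution, parity forces every factor to leave every copy of
`G - g`; as only five edges leave a copy, each of the five factors uses exactly one of them.
Contracting the copies thus turns the factors into perfect matchings of the doubled graph. A perfect
pair would give two such matchings with connected union. If they use parallel edges somewhere, their
union has a component with two vertices; otherwise it is a hamiltonian cycle of `H`. Both are
impossible (`noPair_doubledGrinberg`, `IsFrame.no_connected_pair`).

For `H` serves Grinberg's graph with 46 vertices. Its face lengths are 5, 8 and a single 9, so
Grinberg's criterion fails modulo 3; the proof instead runs through all perfect matchings and finds
that the complement of each is disconnected (`exists_proper_closed`).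

The family is obtained by iterating the substitution from the icosahedron. The induction carries
planarity as a face count (`card_orbits_substitute`), 5-connectedness (`noSeparator_substitute`), a
colouring (`exists_colouring_substitute`), and two nonadjacent vertices `g`, `a` whose faces are
triangles. The triangles at `g` make the face count easy; copies of `a` in two different places are
the new `g` and `a`.

Plane graphs are encoded by their dart reversal on `V × Fin d`, the rotation being addition of 1 in
`Fin d`. Finite facts about the two concrete graphs are checked by evaluation, the large ones by a
branch-and-bound search whose states are the binary digits of a natural number. -/

/-- The reversal map `r` of the darts `V × Fin d` of a `d`-regular loopless simple graph; the darts
leaving a vertex are numbered in the cyclic order of an embedding. -/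
structure IsDartMap {V : Type*} {d : ℕ} (r : V × Fin d → V × Fin d) : Prop where
  invol : ∀ x, r (r x) = x
  loopless : ∀ x, (r x).1 ≠ x.1
  simple : ∀ v i j, (r (v, i)).1 = (r (v, j)).1 → i = j

/-- The graph with darts `V × Fin d` and reversal `r`. -/
def dartGraph {V : Type*} {d : ℕ} (r : V × Fin d → V × Fin d) (hr : IsDartMap r) :
    SimpleGraph V where
  Adj u v := ∃ i, (r (u, i)).1 = v
  symm := ⟨by
    rintro u v ⟨i, rfl⟩
    exact ⟨(r (u, i)).2, by rw [Prod.mk.eta, hr.invol]⟩⟩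
  loopless := ⟨by
    rintro u ⟨i, h⟩
    exact hr.loopless _ h⟩

/-- Traverse a dart, then turn to the next dart at its head. -/
def faceStep {V : Type*} {d : ℕ} [NeZero d] (r : V × Fin d → V × Fin d) (x : V × Fin d) :
    V × Fin d :=
  ((r x).1, (r x).2 + 1)

/-- The orbits of a self-map. -/
abbrev Orbits {α : Type*} (f : α → α) : Type _ := Quot fun x y => f x = y

theorem orbits_prop_iff {α : Type*} {f : α → α} (P : α → Prop) (hP : ∀ x, P (f x) ↔ P x) {x y : α}
    (h : Quot.mk (fun x y => f x = y) x = Quot.mk _ y) : P x ↔ P y := by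
  have := congrArg (Quot.lift P (by rintro a _ rfl; exact propext (hP a).symm)) h
  exact iff_of_eq this

/-- The hypothesis `hm` says, through invariant predicates, that a fibre of `F` lies within one
orbit, so numbers of iterations need not be exhibited. -/
theorem card_orbits {α Φ : Type*} (f : α → α) (F : α → Φ) (hs : Function.Surjective F)
    (hi : ∀ x, F (f x) = F x)
    (hm : ∀ P : α → Prop, (∀ x, P (f x) ↔ P x) → ∀ x y, F x = F y → P x → P y) :
    Nat.card (Orbits f) = Nat.card Φ := by
  refine Nat.card_congr (Equiv.ofBijective (Quot.lift F (by rintro a _ rfl; exact (hi a).symm))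
    ⟨?_, ?_⟩)
  · rintro ⟨x⟩ ⟨y⟩ h
    refine (hm (fun z => Quot.mk _ x = Quot.mk _ z) (fun z => ?_) x y h rfl)
    rw [show Quot.mk (fun x y => f x = y) (f z) = Quot.mk (fun x y => f x = y) z from
      (Quot.sound (r := fun x y => f x = y) rfl).symm]
  · intro y
    obtain ⟨x, rfl⟩ := hs y
    exact ⟨Quot.mk _ x, rfl⟩

/-! ### Graphs given by darts: planarity, edge colourings and connectivity. -/

section DartGraph

variable {V : Type*} {d : ℕ} {r : V × Fin d → V × Fin d} (hr : IsDartMap r)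

theorem dartGraph_adj {u v : V} : (dartGraph r hr).Adj u v ↔ ∃ i, (r (u, i)).1 = v := Iff.rfl

/-- The darts of `dartGraph r hr` are `V × Fin d`. -/
noncomputable def dartEquiv : V × Fin d ≃ (dartGraph r hr).Dart :=
  Equiv.ofBijective (fun x => ⟨(x.1, (r x).1), ⟨x.2, rfl⟩⟩) (by
    constructor
    · rintro ⟨u, i⟩ ⟨v, j⟩ h
      have h1 : u = v := congrArg (fun e => e.fst) h
      have h2 : (r (u, i)).1 = (r (v, j)).1 := congrArg (fun e => e.snd) h
      subst h1
      rw [hr.simple _ _ _ h2]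
    · rintro ⟨⟨u, v⟩, i, h⟩
      exact ⟨(u, i), Dart.ext _ _ (Prod.ext rfl h)⟩)

theorem dartEquiv_fst (x : V × Fin d) : (dartEquiv hr x).fst = x.1 := rfl

theorem dartEquiv_symm (x : V × Fin d) : (dartEquiv hr x).symm = dartEquiv hr (r x) := by
  apply Dart.ext
  change ((r x).1, x.1) = ((r x).1, (r (r x)).1)
  rw [hr.invol]

theorem isRegular_dartGraph [Fintype V] : IsRegular (dartGraph r hr) d := by
  classical
  intro v
  rw [← card_neighborFinset_eq_degree]
  have : (dartGraph r hr).neighborFinset v = Finset.univ.image fun i => (r (v, i)).1 := by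
    ext w
    simp [dartGraph_adj]
  convert (Finset.card_image_of_injective Finset.univ (f := fun i => (r (v, i)).1)
    (hr.simple v)).trans (Finset.card_fin d) using 2

/-- The hypothesis `he` is twice Euler's formula for a connected graph, with `2E = dV` inserted. -/
theorem isPlanar_dartGraph [Fintype V] [NeZero d] (hc : (dartGraph r hr).Connected)
    (he : 2 * Nat.card (Orbits (faceStep r)) + 2 * Fintype.card V = d * Fintype.card V + 4) :
    IsPlanar (dartGraph r hr) := by
  classical
  let rot : Equiv.Perm (V × Fin d) := (Equiv.refl V).prodCongr (Equiv.addRight 1)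
  let E := dartEquiv hr
  let σ : Equiv.Perm (dartGraph r hr).Dart := E.permCongr rot
  have hσ : ∀ x, σ (E x) = E (rot x) := fun x => by simp [σ, Equiv.permCongr_apply]
  have hφ : ∀ x, (σ * reversal (dartGraph r hr)) (E x) = E (faceStep r x) := fun x => by
    change σ (E x).symm = _
    rw [dartEquiv_symm hr x, hσ]
    rfl
  refine ⟨σ, ?_, ?_⟩
  · intro a b
    obtain ⟨x, rfl⟩ := E.surjective a
    obtain ⟨y, rfl⟩ := E.surjective b
    rw [dartEquiv_fst, dartEquiv_fst]
    constructor
    · rintro ⟨n, hn⟩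
      have h1 : ∀ z, (σ z).fst = z.fst := fun z => by
        obtain ⟨z, rfl⟩ := E.surjective z
        rw [hσ]; rfl
      have h2 : ∀ (n : ℕ) z, ((σ ^ n) z).fst = z.fst := fun n => by
        induction n with
        | zero => intro z; rfl
        | succ n ih => intro z; rw [pow_succ, Equiv.Perm.mul_apply, ih, h1]
      have h3 : ∀ (n : ℤ) z, ((σ ^ n) z).fst = z.fst := fun n z => by
        cases n with
        | ofNat n => exact h2 n z
        | negSucc n =>
          rw [zpow_negSucc]
          have := h2 (n + 1) ((σ ^ (n + 1))⁻¹ z)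
          rw [← Equiv.Perm.mul_apply, mul_inv_cancel, Equiv.Perm.one_apply] at this
          exact this.symm
      have := h3 n (E x)
      rw [hn] at this
      exact this.symm
    · intro h
      obtain ⟨u, i⟩ := x
      obtain ⟨v, j⟩ := y
      obtain rfl : u = v := h
      have h1 : ∀ n : ℕ, (σ ^ n) (E (u, i)) = E (u, i + Fin.ofNat d n) := fun n => by
        induction n with
        | zero => simp
        | succ n ih =>
          rw [pow_succ', Equiv.Perm.mul_apply, ih, hσ]
          have : Fin.ofNat d (n + 1) = Fin.ofNat d n + 1 := by
            ext
            simp [Fin.val_add]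
          rw [this, ← add_assoc]
          rfl
      refine ⟨((j - i).val : ℕ), ?_⟩
      rw [zpow_natCast, h1, Fin.ofNat_val_eq_self]
      simp
  · have hiso : IsEmpty {v : V // ∀ w, ¬ (dartGraph r hr).Adj v w} :=
      ⟨fun v => v.2 _ ⟨0, rfl⟩⟩
    have hcomp : Nat.card (dartGraph r hr).ConnectedComponent = 1 := by
      rw [Nat.card_eq_one_iff_unique]
      exact ⟨hc.preconnected.subsingleton_connectedComponent,
        ⟨connectedComponentMk _ hc.nonempty.some⟩⟩
    have hface : Nat.card (Orbits (faceStep r)) = Nat.card (Face (dartGraph r hr) σ) := by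
      refine card_orbits _ (fun x => Quotient.mk _ (E x)) ?_ ?_ ?_
      · rintro ⟨a⟩
        obtain ⟨x, rfl⟩ := E.surjective a
        exact ⟨x, rfl⟩
      · intro x
        refine Quotient.sound ?_
        change Equiv.Perm.SameCycle _ _ _
        rw [← hφ]
        exact Equiv.Perm.sameCycle_apply_left.2 (Equiv.Perm.SameCycle.refl _ _)
      · intro P hP x y h hx
        have h' : Equiv.Perm.SameCycle (σ * reversal (dartGraph r hr)) (E x) (E y) :=
          Quotient.exact h
        obtain ⟨n, hn⟩ := h'.exists_nat_pow_eq
        have : ∀ n : ℕ, P (E.symm (((σ * reversal (dartGraph r hr)) ^ n) (E x))) := fun n => by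
          induction n with
          | zero => simpa using hx
          | succ n ih =>
            rw [pow_succ', Equiv.Perm.mul_apply]
            obtain ⟨z, hz⟩ := E.surjective (((σ * reversal (dartGraph r hr)) ^ n) (E x))
            rw [← hz] at ih ⊢
            rw [hφ, Equiv.symm_apply_apply, hP]
            simpa using ih
        have := this n
        rwa [hn, Equiv.symm_apply_apply] at this
    have hedge : 2 * Nat.card (dartGraph r hr).edgeSet = d * Fintype.card V := by
      have h1 := (dartGraph r hr).dart_card_eq_twice_card_edges
      rw [← Fintype.card_congr E, Fintype.card_prod, Fintype.card_fin] at h1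
      rw [Nat.card_eq_fintype_card, ← edgeFinset_card, ← h1, mul_comm]
    rw [Nat.card_of_isEmpty (α := {v : V // _}), hcomp, ← hface,
      Nat.card_eq_fintype_card (α := V)]
    omega

/-- An edge colouring with `d` colours, the colours at every vertex being distinct. -/
structure IsDartColouring {V : Type*} {d : ℕ} (r : V × Fin d → V × Fin d)
    (c : V × Fin d → Fin d) : Prop where
  rev : ∀ x, c (r x) = c x
  inj : ∀ v, Function.Injective fun i => c (v, i)

theorem IsDartColouring.exists_eq {c : V × Fin d → Fin d} (hc : IsDartColouring r c) (v : V)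
    (a : Fin d) : ∃ i, c (v, i) = a :=
  (Finite.injective_iff_surjective.1 (hc.inj v)) a

/-- A colour class as a subgraph. -/
def colourClass {c : V × Fin d → Fin d} (hc : IsDartColouring r c) (a : Fin d) :
    (dartGraph r hr).Subgraph where
  verts := Set.univ
  Adj u v := ∃ i, (r (u, i)).1 = v ∧ c (u, i) = a
  adj_sub := fun ⟨i, h, _⟩ => ⟨i, h⟩
  edge_vert := fun _ => trivial
  symm := ⟨by
    rintro u v ⟨i, rfl, h⟩
    exact ⟨(r (u, i)).2, by rw [Prod.mk.eta, hr.invol], by rw [Prod.mk.eta, hc.rev, h]⟩⟩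

theorem isOneFactorisation_colourClass {c : V × Fin d → Fin d} (hc : IsDartColouring r c) :
    IsOneFactorisation (dartGraph r hr) (Set.range (colourClass hr hc)) := by
  constructor
  · rintro _ ⟨a, rfl⟩
    rw [Subgraph.isPerfectMatching_iff]
    intro v
    obtain ⟨i, hi⟩ := hc.exists_eq v a
    refine ⟨(r (v, i)).1, ⟨i, rfl, hi⟩, ?_⟩
    rintro w ⟨j, rfl, hj⟩
    rw [hc.inj v (hj.trans hi.symm)]
  · intro e
    induction e using Sym2.ind with
    | _ u v =>
      intro h
      obtain ⟨i, rfl⟩ : (dartGraph r hr).Adj u v := h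
      refine ⟨colourClass hr hc (c (u, i)), ⟨⟨_, rfl⟩, ⟨i, rfl, rfl⟩⟩, ?_⟩
      rintro _ ⟨⟨a, rfl⟩, ⟨j, h1, h2⟩⟩
      rw [← h2, hr.simple _ _ _ h1]

/-- Every 1-factorisation is given by a colouring. -/
theorem IsOneFactorisation.exists_colouring [Nonempty V] {𝓕 : Set (dartGraph r hr).Subgraph}
    (h𝓕 : IsOneFactorisation (dartGraph r hr) 𝓕) :
    ∃ c, IsDartColouring r c ∧ ∀ M ∈ 𝓕, ∃ a, ∀ v i, M.Adj v (r (v, i)).1 ↔ c (v, i) = a := by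
  choose M hM hMu using fun x : V × Fin d => h𝓕.2 s(x.1, (r x).1) ⟨x.2, rfl⟩
  simp only [Subgraph.mem_edgeSet] at hM hMu
  let v₀ : V := Classical.arbitrary V
  have key : ∀ N ∈ 𝓕, ∀ v, ∃! i, M (v, i) = N := by
    intro N hN v
    obtain ⟨w, hw, hwu⟩ := Subgraph.isPerfectMatching_iff.1 (h𝓕.1 N hN) v
    obtain ⟨i, rfl⟩ := N.adj_sub hw
    refine ⟨i, (hMu (v, i) N ⟨hN, hw⟩).symm, ?_⟩
    intro j hj
    have := (hM (v, j)).2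
    rw [hj] at this
    exact hr.simple _ _ _ (hwu _ this)
  -- Each factor is named by the number of its dart at the base vertex `v₀`, which makes the colours
  -- elements of `Fin d`.
  choose c₀ hc₀ hcu using fun N : 𝓕 => key N N.2 v₀
  have hinj : Function.Injective c₀ := fun A B h => by
    apply Subtype.ext
    rw [← hc₀ A, ← hc₀ B, h]
  refine ⟨fun x => c₀ ⟨M x, (hM x).1⟩, ⟨?_, ?_⟩, ?_⟩
  · intro x
    congr 2
    refine hMu x _ ⟨(hM _).1, ?_⟩
    have := (hM (r x)).2
    rw [hr.invol] at this
    exact this.symm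
  · intro v i j h
    have := congrArg Subtype.val (hinj h)
    exact (key _ (hM (v, j)).1 v).unique this rfl
  · intro N hN
    refine ⟨c₀ ⟨N, hN⟩, fun v i => ?_⟩
    rw [hinj.eq_iff, Subtype.mk.injEq]
    constructor
    · intro h
      exact (hMu (v, i) N ⟨hN, h⟩).symm
    · rintro rfl
      exact (hM (v, i)).2

/-- Deleting fewer than `k` vertices does not disconnect the graph: a property that propagates
along the surviving edges holds for all surviving vertices or for none. -/
def NoSeparator (r : V × Fin d → V × Fin d) (k : ℕ) : Prop :=
  ∀ (S : Finset V) (P : V → Prop), S.card < k →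
    (∀ x, x.1 ∉ S → (r x).1 ∉ S → P x.1 → P (r x).1) → ∀ u v, u ∉ S → v ∉ S → P u → P v

theorem isKConnected_dartGraph [Fintype V] {k : ℕ} (hk : k < Fintype.card V)
    (h : NoSeparator r k) : IsKConnected (dartGraph r hr) k := by
  classical
  refine ⟨by rw [ENat.card_eq_coe_fintype_card]; exact_mod_cast hk, fun S hS => ?_⟩
  have hcard : S.toFinset.card < k := by
    rw [Set.encard_eq_coe_toFinset_card] at hS
    exact_mod_cast hS
  rw [connected_iff]
  constructor
  · rintro ⟨u, hu⟩ ⟨v, hv⟩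
    have := h S.toFinset
      (fun w => ∃ hw : w ∈ Sᶜ, ((dartGraph r hr).induce Sᶜ).Reachable ⟨u, hu⟩ ⟨w, hw⟩) hcard ?_ u v
      (by simpa using hu) (by simpa using hv) ⟨hu, Reachable.refl _⟩
    · exact this.2
    · rintro x hx1 hx2 ⟨_, hw⟩
      refine ⟨by simpa using hx2, hw.trans (Adj.reachable ?_)⟩
      exact ⟨x.2, rfl⟩
  · by_contra hne
    rw [nonempty_subtype] at hne
    push Not at hne
    have : S.toFinset = Finset.univ := by
      ext v
      simpa using hne v
    rw [this, Finset.card_univ] at hcard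
    omega

theorem connected_dartGraph [Fintype V] {k : ℕ} (hk : k < Fintype.card V) (h0 : 0 < k)
    (h : NoSeparator r k) : (dartGraph r hr).Connected := by
  have : Nonempty V := Fintype.card_pos_iff.1 (by omega)
  refine ⟨fun u v => ?_⟩
  refine h ∅ (fun w => (dartGraph r hr).Reachable u w) (by simpa using h0) ?_ u v (by simp)
    (by simp) (Reachable.refl _)
  intro x _ _ hx
  exact hx.trans (Adj.reachable ⟨x.2, rfl⟩)

/-- A property that propagates along a hamiltonian cycle holds everywhere or nowhere. -/
theorem prop_of_isHamiltonianCycle {V : Type*} [DecidableEq V] {G : SimpleGraph V} {v : V}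
    {p : G.Walk v v} (hp : p.IsHamiltonianCycle) (P : V → Prop)
    (hP : ∀ u w, p.toSubgraph.Adj u w → P u → P w) (u w : V) (hu : P u) : P w := by
  have hc := p.toSubgraph_connected
  have hmem : ∀ x, x ∈ p.toSubgraph.verts := fun x => by
    rw [Walk.mem_verts_toSubgraph]
    exact hp.mem_support x
  obtain ⟨q⟩ := hc.preconnected ⟨u, hmem u⟩ ⟨w, hmem w⟩
  have : ∀ (a b : p.toSubgraph.verts) (q : p.toSubgraph.coe.Walk a b), P a → P b := by
    intro a b q
    induction q with
    | nil => exact id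
    | cons h _ ih => exact fun ha => ih (hP _ _ h ha)
  exact this _ _ q hu

/-- A perfect pair yields a colouring two of whose colour classes have a connected union. -/
theorem IsPerfectPair.exists_colouring [Nonempty V] [DecidableEq V]
    {𝓕 : Set (dartGraph r hr).Subgraph} (h𝓕 : IsOneFactorisation (dartGraph r hr) 𝓕)
    {M M' : (dartGraph r hr).Subgraph} (hM : M ∈ 𝓕) (hM' : M' ∈ 𝓕) (h : IsPerfectPair M M') :
    ∃ c, IsDartColouring r c ∧ ∃ a b, a ≠ b ∧ ∀ P : V → Prop,
      (∀ x, c x = a ∨ c x = b → P x.1 → P (r x).1) → ∀ u v, P u → P v := by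
  obtain ⟨hne, v, p, hp, hsub⟩ := h
  obtain ⟨c, hc, hcM⟩ := h𝓕.exists_colouring
  obtain ⟨a, ha⟩ := hcM M hM
  obtain ⟨b, hb⟩ := hcM M' hM'
  refine ⟨c, hc, a, b, ?_, ?_⟩
  · rintro rfl
    apply hne
    have hadj : ∀ u w, M.Adj u w ↔ M'.Adj u w := fun u w => by
      constructor
      · intro h
        obtain ⟨i, rfl⟩ := M.adj_sub h
        exact (hb _ _).2 ((ha _ _).1 h)
      · intro h
        obtain ⟨i, rfl⟩ := M'.adj_sub h
        exact (ha _ _).2 ((hb _ _).1 h)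
    refine Subgraph.ext ?_ (by ext u w; exact hadj u w)
    rw [(h𝓕.1 M hM).2.verts_eq_univ, (h𝓕.1 M' hM').2.verts_eq_univ]
  · intro P hP
    refine prop_of_isHamiltonianCycle hp P ?_
    intro u w huw
    rw [hsub, Subgraph.sup_adj] at huw
    rcases huw with h | h
    · obtain ⟨i, rfl⟩ := M.adj_sub h
      exact hP (u, i) (Or.inl ((ha _ _).1 h))
    · obtain ⟨i, rfl⟩ := M'.adj_sub h
      exact hP (u, i) (Or.inr ((hb _ _).1 h))

end DartGraph

/-! ### Substitution of `G - g` for the vertices of a multigraph. -/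

/-- Traverse a dart, then turn to the previous dart at its head. -/
def backStep {V : Type*} {d : ℕ} [NeZero d] (r : V × Fin d → V × Fin d) (x : V × Fin d) :
    V × Fin d :=
  ((r x).1, (r x).2 - 1)

section Substitution

variable {V W : Type*} {d : ℕ} {r : V × Fin d → V × Fin d} (hr : IsDartMap r) (g : V)
  (s : W × Fin d → W × Fin d)

/-- The dart that leaves the copy `p.1` of `G - g` in place of the dart from the `p.2`-th neighbour
of `g` to `g`. -/
def exitDart (p : W × Fin d) : (W × {x : V // x ≠ g}) × Fin d :=
  ((p.1, ⟨(r (g, p.2)).1, hr.loopless _⟩), (r (g, p.2)).2)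

open Classical in
/-- Substitution of a copy of `G - g` for each vertex of the multigraph with dart reversal `s`. -/
noncomputable def substitute (y : (W × {x : V // x ≠ g}) × Fin d) :
    (W × {x : V // x ≠ g}) × Fin d :=
  if h : (r (y.1.2.1, y.2)).1 = g then exitDart hr g (s (y.1.1, (r (y.1.2.1, y.2)).2))
  else ((y.1.1, ⟨(r (y.1.2.1, y.2)).1, h⟩), (r (y.1.2.1, y.2)).2)

variable {g s}

theorem exitDart_injective :
    Function.Injective fun p : W × Fin d => (exitDart hr g p).1 := by
  rintro ⟨w, i⟩ ⟨w', j⟩ h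
  have h1 : w = w' := congrArg (fun z => z.1) h
  have h2 : (r (g, i)).1 = (r (g, j)).1 := congrArg (fun z => z.2.1) h
  rw [h1, hr.simple _ _ _ h2]

theorem r_exitDart (p : W × Fin d) :
    r ((exitDart hr g p).1.2.1, (exitDart hr g p).2) = (g, p.2) :=
  hr.invol (g, p.2)

theorem eq_exitDart {y : (W × {x : V // x ≠ g}) × Fin d} (h : (r (y.1.2.1, y.2)).1 = g) :
    y = exitDart hr g (y.1.1, (r (y.1.2.1, y.2)).2) := by
  have : r (g, (r (y.1.2.1, y.2)).2) = (y.1.2.1, y.2) := by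
    rw [show (g, (r (y.1.2.1, y.2)).2) = r (y.1.2.1, y.2) from Prod.ext h.symm rfl, hr.invol]
  refine Prod.ext (Prod.ext rfl (Subtype.ext ?_)) ?_
  · exact (congrArg Prod.fst this).symm
  · exact (congrArg Prod.snd this).symm

theorem eq_exitDart_of_eq {y : (W × {x : V // x ≠ g}) × Fin d} {i : Fin d}
    (h : r (y.1.2.1, y.2) = (g, i)) : y = exitDart hr g (y.1.1, i) := by
  have := eq_exitDart hr (y := y) (by rw [h])
  rwa [h] at this

theorem substitute_exitDart (p : W × Fin d) :
    substitute hr g s (exitDart hr g p) = exitDart hr g (s p) := by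
  have h := r_exitDart hr (g := g) p
  rw [substitute, dif_pos (by rw [h])]
  rw [h]
  rfl

theorem substitute_inner {y : (W × {x : V // x ≠ g}) × Fin d} (h : (r (y.1.2.1, y.2)).1 ≠ g) :
    substitute hr g s y = ((y.1.1, ⟨(r (y.1.2.1, y.2)).1, h⟩), (r (y.1.2.1, y.2)).2) :=
  dif_neg h

theorem isDartMap_substitute (hs : ∀ p, s (s p) = p) (hl : ∀ p, (s p).1 ≠ p.1) :
    IsDartMap (substitute hr g s) := by
  constructor
  · intro y
    by_cases h : (r (y.1.2.1, y.2)).1 = g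
    · rw [eq_exitDart hr h, substitute_exitDart, substitute_exitDart, hs]
    · rw [substitute_inner hr h, substitute_inner hr]
      · refine Prod.ext (Prod.ext rfl (Subtype.ext ?_)) ?_
        · simp only [Prod.mk.eta, hr.invol]
        · simp only [Prod.mk.eta, hr.invol]
      · simp only [Prod.mk.eta, hr.invol]
        exact y.1.2.2
  · intro y
    by_cases h : (r (y.1.2.1, y.2)).1 = g
    · rw [eq_exitDart hr h, substitute_exitDart]
      exact fun h' => hl _ (congrArg (fun z => z.1) h')
    · rw [substitute_inner hr h]
      exact fun h' => hr.loopless _ (congrArg (fun z => z.2.1) h')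
  · rintro ⟨w, x⟩ i j hij
    by_cases hi : (r (x.1, i)).1 = g
    · by_cases hj : (r (x.1, j)).1 = g
      · exact hr.simple _ _ _ (hi.trans hj.symm)
      · rw [eq_exitDart hr (y := ((w, x), i)) hi, substitute_exitDart,
          substitute_inner hr (y := ((w, x), j)) hj] at hij
        exact absurd (congrArg (fun z => z.1) hij) (hl (w, _))
    · by_cases hj : (r (x.1, j)).1 = g
      · rw [eq_exitDart hr (y := ((w, x), j)) hj, substitute_exitDart,
          substitute_inner hr (y := ((w, x), i)) hi] at hij
        exact absurd (congrArg (fun z => z.1) hij).symm (hl (w, _))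
      · rw [substitute_inner hr (y := ((w, x), i)) hi,
          substitute_inner hr (y := ((w, x), j)) hj] at hij
        exact hr.simple _ _ _ (congrArg (fun z => z.2.1) hij)

/-- In each copy the colours of `G` are permuted: `π` turns a colour into the number of the dart at
`g` that bears it, and `b` turns that number into the colour of the corresponding edge of the
multigraph. Both ends of an edge between copies then agree. -/
theorem exists_colouring_substitute {c : V × Fin d → Fin d} (hc : IsDartColouring r c)
    {b : W × Fin d → Fin d} (hb : IsDartColouring s b) :
    ∃ c', IsDartColouring (substitute hr g s) c' := by
  choose π hπ using hc.exists_eq g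
  have hπc : ∀ i, π (c (g, i)) = i := fun i => hc.inj g (hπ _)
  have hπi : Function.Injective π := fun i j h => by rw [← hπ i, h, hπ]
  refine ⟨fun y => b (y.1.1, π (c (y.1.2.1, y.2))), ?_, ?_⟩
  · have key : ∀ p : W × Fin d, b ((exitDart hr g p).1.1,
        π (c ((exitDart hr g p).1.2.1, (exitDart hr g p).2))) = b p := fun p => by
      rw [← hc.rev, r_exitDart hr, hπc]
      rfl
    intro y
    by_cases h : (r (y.1.2.1, y.2)).1 = g
    · rw [eq_exitDart hr h, substitute_exitDart, key, key, hb.rev]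
    · rw [substitute_inner hr h]
      simp only [Prod.mk.eta, hc.rev]
  · rintro ⟨w, x⟩ i j h
    exact hc.inj _ (hπi (hb.inj _ h))

/-- An odd copy is left by an edge of every colour. -/
theorem exists_exitDart_colour [Fintype V] (hV : Even (Fintype.card V))
    {c : (W × {x : V // x ≠ g}) × Fin d → Fin d}
    (hc : IsDartColouring (substitute hr g s) c) (w : W) (a : Fin d) :
    ∃ i, c (exitDart hr g (w, i)) = a := by
  classical
  by_contra! hne
  choose k hk using fun x : {x : V // x ≠ g} => hc.exists_eq (w, x) a
  have hin : ∀ x, (r (x.1, k x)).1 ≠ g := fun x h => by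
    apply hne (r (x.1, k x)).2
    rw [← hk x]
    exact congrArg c (eq_exitDart hr (y := ((w, x), k x)) h).symm
  -- If colour `a` never leaves the copy, it matches the vertices of the copy among themselves,
  -- whereas their number is odd.
  let ν : {x : V // x ≠ g} → {x : V // x ≠ g} := fun x => ⟨_, hin x⟩
  have hkν : ∀ x, k (ν x) = (r (x.1, k x)).2 := fun x => by
    apply hc.inj (w, ν x)
    have := hc.rev ((w, x), k x)
    rw [substitute_inner hr (y := ((w, x), k x)) (hin x), hk x] at this
    exact (hk _).trans this.symm
  have hν : ∀ x, ν (ν x) = x := fun x => by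
    apply Subtype.ext
    change (r ((r (x.1, k x)).1, k (ν x))).1 = _
    rw [hkν, Prod.mk.eta, hr.invol]
  have hνne : ∀ x, ν x ≠ x := fun x h => hr.loopless _ (congrArg Subtype.val h)
  have h1 : Even (Fintype.card {x : V // x ≠ g}) := by
    -- A sum of ones in `ZMod 2`, cancelled in pairs by the fixed-point-free involution, shows that
    -- the cardinality is even.
    have := Finset.sum_involution (s := Finset.univ) (f := fun _ : {x : V // x ≠ g} => (1 : ZMod 2))
      (fun x _ => ν x) (fun _ _ => by decide) (fun x _ _ => hνne x) (fun _ _ => Finset.mem_univ _)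
      (fun x _ => hν x)
    rw [Finset.sum_const, Finset.card_univ, nsmul_one] at this
    exact (ZMod.natCast_eq_zero_iff_even).1 this
  have h2 : Fintype.card {x : V // x ≠ g} = Fintype.card V - 1 := by
    rw [Fintype.card_subtype_compl, Fintype.card_subtype_eq]
  have h3 : 0 < Fintype.card V := Fintype.card_pos_iff.2 ⟨g⟩
  rw [h2] at h1
  obtain ⟨m, hm⟩ := hV
  obtain ⟨m', hm'⟩ := h1
  omega

section Faces

variable [NeZero d]

theorem faceStep_injective (hr : IsDartMap r) : Function.Injective (faceStep r) := by
  intro x y h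
  have h1 : (r x).1 = (r y).1 := congrArg (fun z => z.1) h
  have h2 : (r x).2 + 1 = (r y).2 + 1 := congrArg (fun z => z.2) h
  rw [← hr.invol x, ← hr.invol y, Prod.ext h1 (add_right_cancel h2)]

theorem faceStep_substitute_inner {y : (W × {x : V // x ≠ g}) × Fin d}
    (h : (r (y.1.2.1, y.2)).1 ≠ g) :
    faceStep (substitute hr g s) y =
      ((y.1.1, ⟨(faceStep r (y.1.2.1, y.2)).1, h⟩), (faceStep r (y.1.2.1, y.2)).2) := by
  rw [faceStep, substitute_inner hr h]
  rfl

theorem faceStep_exitDart (p : W × Fin d) :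
    faceStep (substitute hr g s) (exitDart hr g p) =
      (((s p).1, ⟨(faceStep r (g, (s p).2)).1, hr.loopless _⟩), (faceStep r (g, (s p).2)).2) := by
  rw [faceStep, substitute_exitDart]
  rfl

theorem r_faceStep_twice
    (htri : ∀ i, faceStep r (faceStep r (faceStep r (g, i))) = (g, i)) (i : Fin d) :
    r (faceStep r (faceStep r (g, i))) = (g, i - 1) := by
  have h := htri i
  rw [faceStep, Prod.mk.injEq] at h
  exact Prod.ext h.1 (eq_sub_of_add_eq h.2)

theorem r_faceStep_ne (hr : IsDartMap r)
    (htri : ∀ i, faceStep r (faceStep r (faceStep r (g, i))) = (g, i)) (i : Fin d) :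
    (r (faceStep r (g, i))).1 ≠ g := by
  have h := r_faceStep_twice htri i
  intro h'
  have := hr.loopless (faceStep r (faceStep r (g, i)))
  rw [h] at this
  exact this h'.symm

/-- After entering a copy at the `i`-th neighbour of `g`, a face follows the side opposite `g` of
the `i`-th triangle and leaves by exit `i - 1`. Numbers thus decrease, which is why faces of the
multigraph are counted with `backStep`. -/
theorem faceStep_twice_exitDart
    (htri : ∀ i, faceStep r (faceStep r (faceStep r (g, i))) = (g, i)) (p : W × Fin d) :
    faceStep (substitute hr g s) (faceStep (substitute hr g s) (exitDart hr g p)) =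
      exitDart hr g (backStep s p) := by
  rw [faceStep_exitDart]
  have h := r_faceStep_ne hr htri (s p).2
  rw [faceStep_substitute_inner hr (by exact h)]
  have h' := r_faceStep_twice htri (s p).2
  exact eq_exitDart_of_eq hr h'

theorem mem_triangle_of_orbit_eq (hr : IsDartMap r)
    (htri : ∀ i, faceStep r (faceStep r (faceStep r (g, i))) = (g, i)) {x : V × Fin d} {i : Fin d}
    (h : Quot.mk (fun x y => faceStep r x = y) x = Quot.mk _ (g, i)) :
    x = (g, i) ∨ x = faceStep r (g, i) ∨ x = faceStep r (faceStep r (g, i)) := by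
  refine (orbits_prop_iff (fun x => x = (g, i) ∨ x = faceStep r (g, i) ∨
    x = faceStep r (faceStep r (g, i))) (fun z => ?_) h).2 (Or.inl rfl)
  have hinj := faceStep_injective hr
  rw [hinj.eq_iff, hinj.eq_iff]
  nth_rewrite 1 [← htri i]
  rw [hinj.eq_iff]
  tauto

/-- Only one of the three darts of a triangle at `g` starts at `g`, so the `d` faces there are
distinct. -/
theorem orbit_injective (hr : IsDartMap r)
    (htri : ∀ i, faceStep r (faceStep r (faceStep r (g, i))) = (g, i)) :
    Function.Injective fun i => Quot.mk (fun x y => faceStep r x = y) (g, i) := by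
  intro i j h
  rcases mem_triangle_of_orbit_eq hr htri h with h | h | h
  · exact congrArg Prod.snd h
  · exact absurd (congrArg Prod.fst h).symm (hr.loopless _)
  · exfalso
    have := r_faceStep_twice htri j
    rw [← h] at this
    exact hr.loopless (g, i) (show (r (g, i)).1 = g by rw [this])

/-- A face of the substitution either lies inside one copy, where it is a face of `G` not at `g`, or
it follows a face of the multigraph, cutting through one former triangle at `g` in every copy that
it visits. -/
theorem card_orbits_substitute [Finite V] [Finite W]
    (htri : ∀ i, faceStep r (faceStep r (faceStep r (g, i))) = (g, i)) :
    Nat.card (Orbits (faceStep (substitute hr g s))) =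
      Nat.card (Orbits (backStep s)) + Nat.card W * (Nat.card (Orbits (faceStep r)) - d) := by
  classical
  let O := Orbits (faceStep r)
  let mk : V × Fin d → O := Quot.mk _
  let Φ := Orbits (backStep s) ⊕ W × {f : O // ∀ i, f ≠ mk (g, i)}
  have hmk : ∀ x, mk (faceStep r x) = mk x := fun x =>
    (Quot.sound (r := fun x y => faceStep r x = y) rfl).symm
  let F₀ : W → O → Φ := fun w f =>
    if h : ∃ i, f = mk (g, i) then Sum.inl (Quot.mk _ (w, h.choose - 1))
    else Sum.inr (w, ⟨f, not_exists.1 h⟩)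
  have hF₀ : ∀ w i, F₀ w (mk (g, i)) = Sum.inl (Quot.mk _ (w, i - 1)) := fun w i => by
    have h : ∃ j, mk (g, i) = mk (g, j) := ⟨i, rfl⟩
    have h' : h.choose = i := orbit_injective hr htri h.choose_spec.symm
    simp only [F₀]
    rw [dif_pos h, h']
  let F : (W × {x : V // x ≠ g}) × Fin d → Φ := fun y => F₀ y.1.1 (mk (y.1.2.1, y.2))
  -- The dart entering `g` as the reverse of number `p.2` is followed by number `p.2 + 1`; hence the
  -- shift by one in `F₀`.
  have hexit : ∀ p : W × Fin d, mk ((exitDart hr g p).1.2.1, (exitDart hr g p).2) =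
      mk (g, p.2 + 1) := fun p => by
    rw [← hmk, faceStep, r_exitDart hr]
  have hcard : Nat.card Φ =
      Nat.card (Orbits (backStep s)) + Nat.card W * (Nat.card (Orbits (faceStep r)) - d) := by
    have h1 : Nat.card {f : O // ∀ i, f ≠ mk (g, i)} = Nat.card O - d := by
      have h2 : {f : O | ∀ i, f ≠ mk (g, i)} = (Set.range fun i => mk (g, i))ᶜ := by
        ext f
        simp [eq_comm]
      have h3 := Set.ncard_add_ncard_compl (Set.range fun i => mk (g, i))
      rw [← h2, ← Set.image_univ, Set.ncard_image_of_injective _ (orbit_injective hr htri),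
        Set.ncard_univ, Nat.card_fin] at h3
      change Set.ncard {f : O | ∀ i, f ≠ mk (g, i)} = _
      omega
    rw [Nat.card_sum, Nat.card_prod, h1]
  rw [← hcard]
  refine card_orbits _ F ?_ ?_ ?_
  · rintro (⟨⟨w, i⟩⟩ | ⟨w, f, hf⟩)
    · refine ⟨exitDart hr g (w, i), ?_⟩
      simp only [F]
      rw [hexit, hF₀, add_sub_cancel_right]
      rfl
    · obtain ⟨⟨x, j⟩, rfl⟩ := Quot.exists_rep f
      have hx : x ≠ g := by
        rintro rfl
        exact hf j rfl
      refine ⟨((w, ⟨x, hx⟩), j), ?_⟩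
      simp only [F, F₀]
      rw [dif_neg (by push Not; exact hf)]
  · intro y
    by_cases h : (r (y.1.2.1, y.2)).1 = g
    · rw [eq_exitDart hr h, faceStep_exitDart]
      generalize (y.1.1, (r (y.1.2.1, y.2)).2) = p
      simp only [F, hexit, Prod.mk.eta, hmk, hF₀, add_sub_cancel_right]
      exact congrArg Sum.inl (Quot.sound (r := fun x y => backStep s x = y) rfl).symm
    · rw [faceStep_substitute_inner hr h]
      simp only [F, Prod.mk.eta, hmk]
  · intro P hP y z hyz hy
    -- Of the three darts of a triangle at `g` two survive in the copy: the side opposite `g`, and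
    -- the exit dart that follows it.
    have hbase : ∀ (y : (W × {x : V // x ≠ g}) × Fin d) (i : Fin d),
        mk (y.1.2.1, y.2) = mk (g, i) → (P y ↔ P (exitDart hr g (y.1.1, i - 1))) := by
      intro y i hyi
      rcases mem_triangle_of_orbit_eq hr htri hyi with h | h | h
      · exact absurd (congrArg Prod.fst h) y.1.2.2
      · have h1 : (r (y.1.2.1, y.2)).1 ≠ g := by
          rw [h]; exact r_faceStep_ne hr htri i
        rw [← hP y, faceStep_substitute_inner hr h1]
        have h2 := r_faceStep_twice htri i
        rw [← h] at h2
        exact iff_of_eq (congrArg P (eq_exitDart_of_eq hr h2))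
      · have h2 := r_faceStep_twice htri i
        rw [← h] at h2
        exact iff_of_eq (congrArg P (eq_exitDart_of_eq hr h2))
    by_cases h1 : ∃ i, mk (y.1.2.1, y.2) = mk (g, i)
    · obtain ⟨i, hi⟩ := h1
      by_cases h2 : ∃ i, mk (z.1.2.1, z.2) = mk (g, i)
      · obtain ⟨j, hj⟩ := h2
        simp only [F, hi, hj, hF₀] at hyz
        rw [hbase y i hi] at hy
        rw [hbase z j hj]
        refine (orbits_prop_iff (fun p => P (exitDart hr g p)) (fun p => ?_)
          (Sum.inl_injective hyz)).1 hy
        rw [← faceStep_twice_exitDart hr htri, hP, hP]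
      · simp only [F, hi, hF₀, F₀] at hyz
        rw [dif_neg h2] at hyz
        exact absurd hyz (by simp)
    · by_cases h2 : ∃ i, mk (z.1.2.1, z.2) = mk (g, i)
      · obtain ⟨j, hj⟩ := h2
        simp only [F, hj, hF₀, F₀] at hyz
        rw [dif_neg h1] at hyz
        exact absurd hyz (by simp)
      · simp only [F, F₀] at hyz
        rw [dif_neg h1, dif_neg h2] at hyz
        have hyz' := Sum.inr_injective hyz
        have hw : y.1.1 = z.1.1 := congrArg (fun t => t.1) hyz'
        have hf : mk (y.1.2.1, y.2) = mk (z.1.2.1, z.2) := congrArg (fun t => t.2.1) hyz'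
        have := (orbits_prop_iff (f := faceStep r)
          (fun x => ∀ (_ : ∀ i, mk x ≠ mk (g, i)) (hx : x.1 ≠ g),
            P ((y.1.1, ⟨x.1, hx⟩), x.2)) (fun x => ?_) hf).1
          (fun _ _ => hy) (not_exists.1 h2) z.1.2.2
        · rw [hw] at this
          exact this
        · simp only [hmk]
          refine forall_congr' fun hx => ?_
          have hx1 : x.1 ≠ g := fun h => hx x.2 (by rw [← h])
          have hx2 : (faceStep r x).1 ≠ g := fun h => hx (faceStep r x).2 (by rw [← h, ← hmk x])
          have := hP ((y.1.1, ⟨x.1, hx1⟩), x.2)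
          rw [faceStep_substitute_inner hr (by exact hx2)] at this
          exact ⟨fun h _ => this.1 (h hx2), fun h _ => this.2 (h hx1)⟩

end Faces

/-- At most `k` vertices are deleted. If every copy loses fewer than `k`, then deleting `g` as well
still leaves each copy connected, and edge connectivity of the multigraph joins the copies.
Otherwise one copy loses all `k`; the other copies are intact and hang together, and act as the
vertex `g` for the damaged one. -/
theorem noSeparator_substitute [Fintype V] {k : ℕ} (hk : 0 < k) (hG : NoSeparator r (k + 1))
    (hl : ∀ p, (s p).1 ≠ p.1)  (hs : ∀ p, s (s p) = p)
    (hedge : ∀ D : Finset (W × Fin d), D.card < k + 1 → ∀ Q : W → Prop,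
      (∀ p ∉ D, Q p.1 → Q (s p).1) → ∀ u v, Q u → Q v)
    (hvert : ∀ w₀ (Q : W → Prop), (∀ p, p.1 ≠ w₀ → (s p).1 ≠ w₀ → Q p.1 → Q (s p).1) →
      ∀ u v, u ≠ w₀ → v ≠ w₀ → Q u → Q v) [Fintype W] :
    NoSeparator (substitute hr g s) (k + 1) := by
  classical
  intro S P hS hP
  let T : W → Finset V := fun w => (S.filter fun y => y.1 = w).image fun y => y.2.1
  have hT : ∀ (y : W × {x : V // x ≠ g}), y.2.1 ∈ T y.1 ↔ y ∈ S := by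
    rintro ⟨w, x⟩
    simp only [T, Finset.mem_image, Finset.mem_filter]
    constructor
    · rintro ⟨⟨w', x'⟩, ⟨h, rfl⟩, h2⟩
      rwa [← Subtype.ext h2]
    · exact fun h => ⟨_, ⟨h, rfl⟩, rfl⟩
  have hcopy : ∀ w, (S.filter fun y => y.1 = w).card < k → ∀ x y : {x : V // x ≠ g},
      (w, x) ∉ S → (w, y) ∉ S → P (w, x) → P (w, y) := by
    intro w hw x y hx hy hPx
    have hcard : (insert g (T w)).card < k + 1 := by
      have h1 := Finset.card_insert_le g (T w)
      have h2 : (T w).card ≤ _ := Finset.card_image_le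
      omega
    refine hG (insert g (T w)) (fun v => ∀ h : v ≠ g, P (w, ⟨v, h⟩)) hcard ?_ x.1 y.1 ?_ ?_
      (fun _ => hPx) y.2
    · rintro ⟨v, i⟩ h1 h2 h3 h4
      rw [Finset.mem_insert, not_or] at h1 h2
      have := hP ((w, ⟨v, h1.1⟩), i) ((hT (w, ⟨v, h1.1⟩)).not.1 h1.2)
      rw [substitute_inner hr (by exact h4)] at this
      exact this ((hT (w, ⟨_, h4⟩)).not.1 h2.2) (h3 h1.1)
    · rw [Finset.mem_insert, not_or]
      exact ⟨x.2, (hT (w, x)).not.2 hx⟩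
    · rw [Finset.mem_insert, not_or]
      exact ⟨y.2, (hT (w, y)).not.2 hy⟩
  have hexit : ∀ p, (exitDart hr g p).1 ∉ S → (exitDart hr g (s p)).1 ∉ S →
      P (exitDart hr g p).1 → P (exitDart hr g (s p)).1 := by
    intro p h1 h2
    have := hP (exitDart hr g p) h1
    rw [substitute_exitDart] at this
    exact this h2
  by_cases hbig : ∀ w, (S.filter fun y => y.1 = w).card < k
  · let Q : W → Prop := fun w => ∃ x, (w, x) ∉ S ∧ P (w, x)
    have hQ : ∀ y ∉ S, Q y.1 → P y := by
      rintro ⟨w, y⟩ hy ⟨x, hx, hPx⟩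
      exact hcopy w (hbig w) x y hx hy hPx
    -- Every edge from `Q` to its complement must have a deleted end. Distinct edges have distinct
    -- ends, so there are at most as many as deleted vertices.
    let D : Finset (W × Fin d) := Finset.univ.filter fun p => Q p.1 ∧ ¬ Q (s p).1
    have hD : D.card < k + 1 := by
      refine lt_of_le_of_lt (Finset.card_le_card_of_injOn
        (fun p => if (exitDart hr g p).1 ∈ S then (exitDart hr g p).1 else
          (exitDart hr g (s p)).1) ?_ ?_) hS
      · intro p hp
        have hp : Q p.1 ∧ ¬ Q (s p).1 := by simpa [D] using hp
        simp only
        split_ifs with h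
        · exact h
        · by_contra h'
          refine hp.2 ⟨_, h', hexit p h h' ?_⟩
          exact hQ (exitDart hr g p).1 h hp.1
      · intro p hp q hq hpq
        have hp : Q p.1 ∧ ¬ Q (s p).1 := by simpa [D] using hp
        have hq : Q q.1 ∧ ¬ Q (s q).1 := by simpa [D] using hq
        simp only at hpq
        split_ifs at hpq with h1 h2 h2
        · exact exitDart_injective hr hpq
        · have := exitDart_injective hr hpq
          rw [this] at hp
          exact absurd hp.1 hq.2
        · have := exitDart_injective hr hpq
          rw [← this] at hq
          exact absurd hq.1 hp.2
        · have := exitDart_injective hr hpq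
          rw [← hs p, this, hs]
    intro u v hu hv hPu
    refine hQ v hv (hedge D hD Q ?_ u.1 v.1 ⟨u.2, hu, hPu⟩)
    intro p hp h1
    by_contra h2
    exact hp (by simp [D, h1, h2])
  · push Not at hbig
    obtain ⟨w₀, hw₀⟩ := hbig
    have hSw : ∀ y ∈ S, y.1 = w₀ := by
      have := Finset.eq_of_subset_of_card_le (Finset.filter_subset (fun y => y.1 = w₀) S)
        (by omega)
      intro y hy
      rw [← this, Finset.mem_filter] at hy
      exact hy.2
    have hout : ∀ y : W × {x : V // x ≠ g}, y.1 ≠ w₀ → y ∉ S := fun y h h' => h (hSw y h')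
    have hfar : ∀ y z : W × {x : V // x ≠ g}, y.1 ≠ w₀ → z.1 ≠ w₀ → P y → P z := by
      have hin : ∀ w ≠ w₀, ∀ x y : {x : V // x ≠ g}, P (w, x) → P (w, y) := by
        intro w hw x y
        refine hcopy w ?_ x y (hout _ hw) (hout _ hw)
        rw [Finset.filter_false_of_mem]
        · simpa using hk
        · rintro y hy rfl
          exact hw (hSw y hy)
      intro y z hy hz hPy
      obtain ⟨x, hx⟩ := hvert w₀ (fun w => ∃ x, P (w, x)) (by
        rintro p hp hsp ⟨x, hx⟩
        exact ⟨_, hexit p (hout _ hp) (hout _ hsp) (hin _ hp x _ hx)⟩) y.1 z.1 hy hz ⟨y.2, hPy⟩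
      exact hin _ hz x z.2 hx
    let C : Prop := ∃ y : W × {x : V // x ≠ g}, y.1 ≠ w₀ ∧ P y
    have hT₀ : (T w₀).card < k + 1 := lt_of_le_of_lt
      (Finset.card_image_le.trans (Finset.card_filter_le _ _)) hS
    have hg : g ∉ T w₀ := by
      simp only [T, Finset.mem_image, not_exists, not_and]
      exact fun y _ h => y.2.2 h
    -- The other copies are contracted to `g`, where the predicate is taken to be their common truth
    -- value `C`.
    have hnear := hG (T w₀) (fun v => (v = g ∧ C) ∨ ∃ h : v ≠ g, P (w₀, ⟨v, h⟩)) hT₀ (by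
      rintro ⟨v, i⟩ h1 h2 (⟨h3, y, hy, hPy⟩ | ⟨h3, hPv⟩)
      · simp only at h3
        subst h3
        refine Or.inr ⟨hr.loopless _, ?_⟩
        have h4 := hexit (s (w₀, i)) (hout _ (hl (w₀, i)))
        rw [hs] at h4
        exact h4 ((hT (w₀, ⟨_, hr.loopless (v, i)⟩)).not.1 h2) (hfar y _ hy (hl (w₀, i)) hPy)
      · by_cases h4 : (r (v, i)).1 = g
        · refine Or.inl ⟨h4, ?_⟩
          have h5 := eq_exitDart hr (y := ((w₀, ⟨v, h3⟩), i)) h4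
          have h6 := hexit (w₀, (r (v, i)).2)
          rw [← h5] at h6
          exact ⟨_, hl (w₀, (r (v, i)).2), h6 ((hT (w₀, ⟨_, h3⟩)).not.1 h1) (hout _ (hl (w₀, _))) hPv⟩
        · refine Or.inr ⟨h4, ?_⟩
          have := hP ((w₀, ⟨v, h3⟩), i) ((hT (w₀, ⟨_, h3⟩)).not.1 h1)
          rw [substitute_inner hr (by exact h4)] at this
          exact this ((hT (w₀, ⟨_, h4⟩)).not.1 h2) hPv)
    intro u v hu hv hPu
    have hC : C := by
      by_cases h : u.1 = w₀
      · rcases hnear u.2.1 g (by rw [← h, hT]; exact hu) hg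
          (Or.inr ⟨u.2.2, by rw [← h]; exact hPu⟩) with h' | h'
        · exact h'.2
        · exact absurd rfl h'.1
      · exact ⟨u, h, hPu⟩
    by_cases h : v.1 = w₀
    · rcases hnear g v.2.1 hg (by rw [← h, hT]; exact hv) (Or.inl ⟨rfl, hC⟩) with h' | ⟨h', h''⟩
      · exact absurd h'.1 v.2.2
      · rw [← h] at h''
        exact h''
    · obtain ⟨y, hy, hPy⟩ := hC
      exact hfar y v hy h hPy

end Substitution

/-! ### Invariance under renaming of vertices. -/

section Relabel

variable {U V : Type*} {d : ℕ} (e : U ≃ V) (r : U × Fin d → U × Fin d)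

/-- Renaming the vertices. -/
def relabel (y : V × Fin d) : V × Fin d :=
  (e (r (e.symm y.1, y.2)).1, (r (e.symm y.1, y.2)).2)

variable {r}

theorem relabel_apply (u : U) (i : Fin d) :
    relabel e r (e u, i) = (e (r (u, i)).1, (r (u, i)).2) := by
  simp [relabel]

theorem IsDartMap.relabel (hr : IsDartMap r) : IsDartMap (relabel e r) := by
  constructor
  · rintro ⟨v, i⟩
    obtain ⟨u, rfl⟩ := e.surjective v
    rw [relabel_apply, relabel_apply, Prod.mk.eta, hr.invol]
  · rintro ⟨v, i⟩
    obtain ⟨u, rfl⟩ := e.surjective v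
    rw [relabel_apply]
    exact fun h => hr.loopless _ (e.injective h)
  · intro v i j h
    obtain ⟨u, rfl⟩ := e.surjective v
    rw [relabel_apply, relabel_apply] at h
    exact hr.simple _ _ _ (e.injective h)

theorem IsDartColouring.relabel {c : U × Fin d → Fin d} (hc : IsDartColouring r c) :
    IsDartColouring (relabel e r) fun y => c (e.symm y.1, y.2) := by
  constructor
  · rintro ⟨v, i⟩
    obtain ⟨u, rfl⟩ := e.surjective v
    simp only [relabel_apply, Equiv.symm_apply_apply, Prod.mk.eta, hc.rev]
  · intro v i j h
    exact hc.inj _ h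

theorem IsDartColouring.of_relabel {c : V × Fin d → Fin d}
    (hc : IsDartColouring (PerfectPairs.relabel e r) c) :
    IsDartColouring r fun y => c (e y.1, y.2) := by
  constructor
  · rintro ⟨u, i⟩
    have := hc.rev (e u, i)
    rwa [relabel_apply] at this
  · intro u i j h
    exact hc.inj _ h

theorem NoSeparator.relabel {k : ℕ} (h : NoSeparator r k) : NoSeparator (relabel e r) k := by
  intro S P hS hP u v hu hv
  obtain ⟨u, rfl⟩ := e.surjective u
  obtain ⟨v, rfl⟩ := e.surjective v
  have hmem : ∀ x, x ∈ S.map e.symm.toEmbedding ↔ e x ∈ S := fun x => by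
    simp [Finset.mem_map_equiv]
  refine h (S.map e.symm.toEmbedding) (fun x => P (e x)) (by rwa [Finset.card_map]) ?_ u v
    ((hmem u).not.2 hu) ((hmem v).not.2 hv)
  rintro ⟨x, i⟩ h1 h2 h3
  have := hP (e x, i) ((hmem _).not.1 h1)
  rw [relabel_apply] at this
  exact this ((hmem _).not.1 h2) h3

theorem faceStep_relabel [NeZero d] (x : U × Fin d) :
    faceStep (relabel e r) (e x.1, x.2) = (e (faceStep r x).1, (faceStep r x).2) := by
  rw [faceStep, relabel_apply]
  rfl

theorem card_orbits_relabel [NeZero d] :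
    Nat.card (Orbits (faceStep (relabel e r))) = Nat.card (Orbits (faceStep r)) := by
  symm
  refine card_orbits _ (fun x => Quot.mk _ (e x.1, x.2)) ?_ ?_ ?_
  · rintro ⟨v, i⟩
    exact ⟨(e.symm v, i), by simp⟩
  · intro x
    rw [← faceStep_relabel]
    exact (Quot.sound (r := fun x y => faceStep (relabel e r) x = y) rfl).symm
  · intro P hP x y hxy hx
    have := (orbits_prop_iff (f := faceStep (relabel e r)) (fun z => P (e.symm z.1, z.2))
      (fun z => ?_) hxy).1 (by simpa using hx)
    · simpa using this
    · obtain ⟨v, i⟩ := z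
      obtain ⟨u, rfl⟩ := e.surjective v
      rw [faceStep_relabel e (u, i)]
      simpa using hP (u, i)

end Relabel

/-! ### The induction step, and the exclusion of perfect pairs. -/

/-- A 5-connected, 5-edge-coloured quintic plane graph with two nonadjacent vertices `g` and `a`
all of whose faces are triangles. -/
structure IsQuintic {V : Type*} [Fintype V] (r : V × Fin 5 → V × Fin 5) (g a : V) : Prop
    extends IsDartMap r where
  euler : 2 * Nat.card (Orbits (faceStep r)) = 3 * Fintype.card V + 4
  noSep : NoSeparator r 5
  colour : ∃ c, IsDartColouring r c
  large : 5 < Fintype.card V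
  ne : a ≠ g
  far : ∀ i, (r (a, i)).1 ≠ g
  triangle_left : ∀ i, faceStep r (faceStep r (faceStep r (g, i))) = (g, i)
  triangle_right : ∀ i, faceStep r (faceStep r (faceStep r (a, i))) = (a, i)

/-- A 5-edge-connected, 5-edge-coloured quintic plane multigraph that stays connected when a vertex
is deleted, and no two perfect matchings of which form a hamiltonian cycle. -/
structure IsFrame {W : Type*} [Fintype W] (s : W × Fin 5 → W × Fin 5) : Prop where
  invol : ∀ p, s (s p) = p
  loopless : ∀ p, (s p).1 ≠ p.1
  euler : 2 * Nat.card (Orbits (backStep s)) = 3 * Fintype.card W + 4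
  colour : ∃ c, IsDartColouring s c
  edgeConn : ∀ D : Finset (W × Fin 5), D.card < 5 → ∀ Q : W → Prop,
    (∀ p ∉ D, Q p.1 → Q (s p).1) → ∀ u v, Q u → Q v
  vertexConn : ∀ w₀ (Q : W → Prop), (∀ p, p.1 ≠ w₀ → (s p).1 ≠ w₀ → Q p.1 → Q (s p).1) →
    ∀ u v, u ≠ w₀ → v ≠ w₀ → Q u → Q v
  noPair : ∀ j j' : W → Fin 5, (∀ w, (s (w, j w)).2 = j (s (w, j w)).1) →
    (∀ w, (s (w, j' w)).2 = j' (s (w, j' w)).1) → (∀ w, j w ≠ j' w) →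
    ∃ Q : W → Prop, (∃ w, Q w) ∧ (∃ w, ¬ Q w) ∧
      ∀ w, Q w → Q (s (w, j w)).1 ∧ Q (s (w, j' w)).1

section Quintic

variable {V : Type*} [Fintype V] {r : V × Fin 5 → V × Fin 5} {g a : V}

theorem IsQuintic.relabel (h : IsQuintic r g a) {V' : Type*} [Fintype V'] (e : V ≃ V') :
    IsQuintic (relabel e r) (e g) (e a) where
  toIsDartMap := h.toIsDartMap.relabel e
  euler := by rw [card_orbits_relabel, h.euler, Fintype.card_congr e]
  noSep := h.noSep.relabel e
  colour := h.colour.elim fun _ hc => ⟨_, hc.relabel e⟩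
  large := by rw [← Fintype.card_congr e]; exact h.large
  ne := fun h' => h.ne (e.injective h')
  far := fun i => by
    rw [relabel_apply]
    exact fun h' => h.far i (e.injective h')
  triangle_left := fun i => by
    rw [faceStep_relabel e (g, i), faceStep_relabel, faceStep_relabel,
      h.triangle_left]
  triangle_right := fun i => by
    rw [faceStep_relabel e (a, i), faceStep_relabel, faceStep_relabel,
      h.triangle_right]

theorem IsQuintic.even_card (h : IsQuintic r g a) : Even (Fintype.card V) := by
  have := h.euler
  rw [Nat.even_iff]
  omega

theorem IsQuintic.isPlanar (h : IsQuintic r g a) : IsPlanar (dartGraph r h.toIsDartMap) := by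
  refine isPlanar_dartGraph _ (connected_dartGraph _ h.large (by norm_num) h.noSep) ?_
  have := h.euler
  omega

theorem IsQuintic.isKConnected (h : IsQuintic r g a) : IsKConnected (dartGraph r h.toIsDartMap) 5 :=
  isKConnected_dartGraph _ h.large h.noSep

theorem IsQuintic.exists_isOneFactorisation (h : IsQuintic r g a) :
    ∃ 𝓕, IsOneFactorisation (dartGraph r h.toIsDartMap) 𝓕 :=
  h.colour.elim fun _ hc => ⟨_, isOneFactorisation_colourClass _ hc⟩

variable {W : Type*} [Fintype W] {s : W × Fin 5 → W × Fin 5}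

/-- The substitution of copies of `G - g` into a frame. -/
theorem IsQuintic.substitute (h : IsQuintic r g a) (hs : IsFrame s)
    [DecidableEq V] {w₀ w₁ : W} (hw : w₁ ≠ w₀) :
    IsQuintic (substitute h.toIsDartMap g s) (w₀, ⟨a, h.ne⟩) (w₁, ⟨a, h.ne⟩) := by
  have htri : ∀ w i, faceStep (PerfectPairs.substitute h.toIsDartMap g s)
      (faceStep (PerfectPairs.substitute h.toIsDartMap g s)
        (faceStep (PerfectPairs.substitute h.toIsDartMap g s) ((w, ⟨a, h.ne⟩), i))) =
      ((w, ⟨a, h.ne⟩), i) := by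
    intro w i
    -- The triangles at `a` survive because none of their darts enters `g`: the heads are neighbours
    -- of `a`, and `a` itself.
    have h3 : (r (faceStep r (faceStep r (a, i)))).1 ≠ g := by
      rw [r_faceStep_twice h.triangle_right]
      exact h.ne
    have h2 : (r (faceStep r (a, i))).1 ≠ g := by
      have h2 := r_faceStep_twice h.triangle_right i
      intro h'
      have h5 := h.invol (faceStep r (faceStep r (a, i)))
      rw [h2] at h5
      apply h.far (i - 1)
      rw [h5]
      exact h'
    rw [faceStep_substitute_inner (y := ((w, ⟨a, h.ne⟩), i)) h.toIsDartMap (h.far i)]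
    rw [faceStep_substitute_inner h.toIsDartMap (by exact h2)
      (y := ((w, ⟨(faceStep r (a, i)).1, h.far i⟩), (faceStep r (a, i)).2))]
    rw [faceStep_substitute_inner h.toIsDartMap (by exact h3)]
    have := h.triangle_right i
    exact Prod.ext (Prod.ext rfl (Subtype.ext (congrArg Prod.fst this)))
      (show (faceStep r (faceStep r (faceStep r (a, i)))).2 = i by rw [this])
  have hcard : Fintype.card {x : V // x ≠ g} = Fintype.card V - 1 := by
    rw [Fintype.card_subtype_compl, Fintype.card_subtype_eq]
  have hl := h.large
  have hWW : 1 < Fintype.card W := Fintype.one_lt_card_iff.2 ⟨_, _, hw⟩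
  refine ⟨isDartMap_substitute _ hs.invol hs.loopless, ?_, ?_, ?_, ?_, ?_, ?_, htri _, htri _⟩
  · have h1 := hs.euler
    have h2 := h.euler
    rw [card_orbits_substitute _ h.triangle_left, mul_add, h1, Fintype.card_prod, hcard,
      Nat.card_eq_fintype_card (α := W)]
    obtain ⟨m, hm⟩ : ∃ m, Fintype.card V = m + 1 := ⟨Fintype.card V - 1, by omega⟩
    -- Here `f` is the number of faces of `G` not at `g`, and `m` that of the vertices of a copy.
    obtain ⟨f, hf⟩ : ∃ f, Nat.card (Orbits (faceStep r)) = f + 5 :=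
      ⟨Nat.card (Orbits (faceStep r)) - 5, by omega⟩
    rw [hm, hf] at h2
    rw [hm, hf, Nat.add_sub_cancel, Nat.add_sub_cancel]
    have h3 : 2 * f + 3 = 3 * m := by omega
    nlinarith
  · exact noSeparator_substitute h.toIsDartMap (by norm_num) h.noSep hs.loopless hs.invol
      hs.edgeConn hs.vertexConn
  · obtain ⟨c, hc⟩ := h.colour
    obtain ⟨b, hb⟩ := hs.colour
    exact exists_colouring_substitute _ hc hb
  · rw [Fintype.card_prod, hcard]
    nlinarith [Nat.sub_add_cancel (show 1 ≤ Fintype.card V by omega)]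
  · exact fun h' => hw (congrArg Prod.fst h')
  · intro i
    rw [substitute_inner h.toIsDartMap (h.far i)]
    exact fun h' => hw (congrArg Prod.fst h')

/-- A connected union of two colour classes would project to a hamiltonian cycle of the frame. -/
theorem IsFrame.no_connected_pair (hs : IsFrame s) (h : IsQuintic r g a)
    {c : (W × {x : V // x ≠ g}) × Fin 5 → Fin 5}
    (hc : IsDartColouring (PerfectPairs.substitute h.toIsDartMap g s) c) {α β : Fin 5}
    (hne : α ≠ β) :
    ¬ ∀ P : W × {x : V // x ≠ g} → Prop, (∀ y, c y = α ∨ c y = β → P y.1 →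
      P (PerfectPairs.substitute h.toIsDartMap g s y).1) → ∀ u v, P u → P v := by
  intro hP
  have hex := exists_exitDart_colour h.toIsDartMap h.even_card hc
  -- Five exits show all five colours, so each colour occurs once.
  have hinj : ∀ w, Function.Injective fun i => c (exitDart h.toIsDartMap g (w, i)) := fun w =>
    Finite.injective_iff_surjective.2 (hex w)
  choose j hj using hex
  have hj' : ∀ w i γ, c (exitDart h.toIsDartMap g (w, i)) = γ → i = j w γ := fun w i γ hi =>
    hinj w (hi.trans (hj w γ).symm)
  have hcons : ∀ γ w, (s (w, j w γ)).2 = j (s (w, j w γ)).1 γ := fun γ w => by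
    apply hj'
    rw [Prod.mk.eta, ← substitute_exitDart, hc.rev, hj]
  obtain ⟨Q, ⟨u, hu⟩, ⟨v, hv⟩, hQ⟩ := hs.noPair (fun w => j w α) (fun w => j w β) (hcons α)
    (hcons β) (fun w hw => hne (by rw [← hj w α, hw, hj w β]))
  refine hv (hP (fun y => Q y.1) ?_ (u, ⟨a, h.ne⟩) (v, ⟨a, h.ne⟩) hu)
  intro y hy hQy
  by_cases hyg : (r (y.1.2.1, y.2)).1 = g
  · rw [eq_exitDart h.toIsDartMap hyg] at hy hQy ⊢
    rw [substitute_exitDart]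
    rcases hy with hy | hy
    · have := (hQ y.1.1 hQy).1
      rw [← hj' _ _ _ hy] at this
      exact this
    · have := (hQ y.1.1 hQy).2
      rw [← hj' _ _ _ hy] at this
      exact this
  · rw [substitute_inner h.toIsDartMap hyg]
    exact hQy

theorem IsFrame.not_isPerfectPair (hs : IsFrame s) (h : IsQuintic r g a)
    {U : Type*} [DecidableEq U] (e : W × {x : V // x ≠ g} ≃ U)
    (hr : IsDartMap (PerfectPairs.relabel e (PerfectPairs.substitute h.toIsDartMap g s)))
    {𝓕 : Set (dartGraph _ hr).Subgraph} (h𝓕 : IsOneFactorisation (dartGraph _ hr) 𝓕)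
    {M M' : (dartGraph _ hr).Subgraph} (hM : M ∈ 𝓕) (hM' : M' ∈ 𝓕) : ¬ IsPerfectPair M M' := by
  intro hp
  have : Nonempty U := by
    obtain ⟨v, -⟩ := hp.2
    exact ⟨v⟩
  obtain ⟨c, hc, α, β, hne, hP⟩ := hp.exists_colouring hr h𝓕 hM hM'
  refine hs.no_connected_pair h hc.of_relabel hne ?_
  intro P h1 u v hu
  have := hP (fun x => P (e.symm x)) (by
    rintro ⟨x, i⟩ hx hPx
    obtain ⟨x, rfl⟩ := e.surjective x
    rw [relabel_apply]
    simp only [Equiv.symm_apply_apply] at hPx ⊢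
    exact h1 (x, i) hx hPx) (e u) (e v) (by simpa using hu)
  simpa using this

theorem IsFrame.isSubstitution (hs : IsFrame s) (h : IsQuintic r g a)
    {U : Type*} (e : W × {x : V // x ≠ g} ≃ U)
    (hr : IsDartMap (PerfectPairs.relabel e (PerfectPairs.substitute h.toIsDartMap g s)))
    {m : W → W → ℕ} (hm : ∀ w w', w ≠ w' → {i | (s (w, i)).1 = w'}.encard = m w w') :
    IsSubstitution m (dartGraph r h.toIsDartMap) g (dartGraph _ hr) := by
  have hadj : ∀ y z, (dartGraph _ hr).Adj (e y) (e z) ↔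
      ∃ i, (PerfectPairs.substitute h.toIsDartMap g s (y, i)).1 = z := fun y z => by
    rw [dartGraph_adj]
    simp only [relabel_apply, e.injective.eq_iff]
  have hout : ∀ y i, (PerfectPairs.substitute h.toIsDartMap g s (y, i)).1.1 ≠ y.1 →
      (r (y.2.1, i)).1 = g := by
    intro y i hy
    by_contra hg
    rw [substitute_inner _ hg] at hy
    exact hy rfl
  have hexit : ∀ p, (PerfectPairs.substitute h.toIsDartMap g s
      ((exitDart h.toIsDartMap g p).1, (exitDart h.toIsDartMap g p).2)).1 =
      (exitDart h.toIsDartMap g (s p)).1 := fun p => by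
    rw [Prod.mk.eta, substitute_exitDart]
  refine ⟨e, ?_, ?_, ?_, ?_⟩
  · intro w x y
    rw [hadj, dartGraph_adj]
    refine exists_congr fun i => ?_
    by_cases hi : (r (x.1, i)).1 = g
    · rw [eq_exitDart h.toIsDartMap (y := ((w, x), i)) hi, substitute_exitDart]
      constructor
      · intro h'
        exact absurd (congrArg Prod.fst h') (hs.loopless _)
      · intro h'
        exact absurd (h'.symm.trans hi) y.2
    · rw [substitute_inner _ (y := ((w, x), i)) hi]
      simp [Prod.ext_iff, Subtype.ext_iff]
  · rintro w ⟨x, hx⟩ ⟨i, rfl⟩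
    refine ⟨(exitDart h.toIsDartMap g (s (w, i))).1, ⟨hs.loopless _, ?_⟩, ?_⟩
    · exact (hadj _ _).2 ⟨_, hexit (w, i)⟩
    · rintro q ⟨h1, h2⟩
      obtain ⟨k, rfl⟩ := (hadj _ _).1 h2
      have h3 := hout _ _ h1
      have h4 : k = (r (g, i)).2 := by
        apply h.simple (r (g, i)).1
        rw [Prod.mk.eta, h.invol]
        exact h3
      rw [h4]
      exact hexit (w, i)
  · intro w x q h1 h2
    obtain ⟨k, rfl⟩ := (hadj _ _).1 h2
    exact SimpleGraph.Adj.symm ⟨k, hout _ _ h1⟩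
  · intro w w' hw
    rw [← hm w w' hw]
    have : {z : {x : V // x ≠ g} × {x : V // x ≠ g} |
        (dartGraph _ hr).Adj (e (w, z.1)) (e (w', z.2))} =
        (fun i => ((exitDart h.toIsDartMap g (w, i)).1.2,
          (exitDart h.toIsDartMap g (s (w, i))).1.2)) '' {i | (s (w, i)).1 = w'} := by
      ext ⟨x, y⟩
      simp only [Set.mem_ofPred_eq, Set.mem_image, hadj]
      constructor
      · rintro ⟨k, hk⟩
        have h3 : (r (x.1, k)).1 = g := hout (w, x) k (by rw [hk]; exact hw.symm)
        have h4 := eq_exitDart h.toIsDartMap (y := ((w, x), k)) h3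
        rw [h4, substitute_exitDart] at hk
        refine ⟨(r (x.1, k)).2, congrArg Prod.fst hk, Prod.ext ?_ (congrArg (fun z => z.2) hk)⟩
        exact (congrArg (fun z => z.1.2) h4).symm
      · rintro ⟨i, rfl, hi⟩
        rw [Prod.mk.injEq] at hi
        refine ⟨(exitDart h.toIsDartMap g (w, i)).2, ?_⟩
        rw [← hi.1, ← hi.2]
        exact hexit (w, i)
    rw [this, Function.Injective.encard_image]
    intro i i' h'
    have h1 : (r (g, i)).1 = (r (g, i')).1 := congrArg (fun z => z.1.1) h'
    exact h.simple _ _ _ h1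

end Quintic

/-! ### Branch and bound on binary digits: edge cuts and separators. -/

section Search

/-- The number whose binary digits 1 are at the given places. -/
def bitsOf (l : List ℕ) : ℕ := l.foldr (fun i a => 2 ^ i ||| a) 0

theorem testBit_bitsOf (l : List ℕ) (i : ℕ) : (bitsOf l).testBit i = true ↔ i ∈ l := by
  induction l with
  | nil => simp [bitsOf]
  | cons a l ih =>
    change (2 ^ a ||| bitsOf l).testBit i = true ↔ _
    rw [Nat.testBit_or, Bool.or_eq_true, ih, Nat.testBit_two_pow, decide_eq_true_iff, List.mem_cons,
      eq_comm]

/-- A step of a search: it is possible if the places in `mask` carry the digits of `value`, and it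
sets the places in `new`. -/
structure Branch where
  new : ℕ
  cost : ℕ
  mask : ℕ
  value : ℕ

/-- Set the places in `set` at cost `c`, provided that all places in `on` and none in `off` are
set. -/
def branch (set : List ℕ) (c : ℕ) (on off : List ℕ) : Branch :=
  ⟨bitsOf set, c, bitsOf (on ++ off), bitsOf on⟩

/-- A conditional that reduces fast. -/
def choose (a b c : Bool) : Bool := Bool.rec c b a

/-- Whether all branches that are possible for `m` and affordable for `c` lead to success. -/
def tryAll (m c : ℕ) (next : ℕ → ℕ → Bool) : List Branch → Bool :=
  List.rec true fun o _ ih => choose (Nat.beq (m &&& o.mask) o.value)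
    (choose (Nat.ble o.cost c) (choose (next (m ||| o.new) (c - o.cost)) ih false) ih) ih

/-- Branch and bound: `m` records the choices made and `c` is the remaining budget. It succeeds if
`ok` holds for all outcomes. -/
def search (ok : ℕ → Bool) : List (List Branch) → ℕ → ℕ → Bool :=
  List.rec (fun m _ => ok m) fun row _ ih m c => tryAll m c ih row

/-- The branches for `n - 1, …, 0`. -/
def rowsFrom (row : ℕ → List Branch) : ℕ → List (List Branch)
  | 0 => []
  | n + 1 => row n :: rowsFrom row n

theorem tryAll_cons (m c : ℕ) (next : ℕ → ℕ → Bool) (o : Branch) (l : List Branch) :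
    tryAll m c next (o :: l) = choose (Nat.beq (m &&& o.mask) o.value)
      (choose (Nat.ble o.cost c) (choose (next (m ||| o.new) (c - o.cost)) (tryAll m c next l) false)
        (tryAll m c next l)) (tryAll m c next l) := rfl

theorem choose_eq (a b c : Bool) : choose a b c = if a = true then b else c := by
  cases a <;> rfl

theorem next_of_tryAll {m c : ℕ} {next : ℕ → ℕ → Bool} {l : List Branch} {o : Branch}
    (h : tryAll m c next l = true) (ho : o ∈ l) (hm : m &&& o.mask = o.value) (hc : o.cost ≤ c) :
    next (m ||| o.new) (c - o.cost) = true := by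
  induction l with
  | nil => simp at ho
  | cons a l ih =>
    rw [tryAll_cons] at h
    simp only [choose_eq] at h
    rcases List.mem_cons.1 ho with rfl | ho
    · rw [if_pos (by rw [Nat.beq_eq, hm]), if_pos (by rw [Nat.ble_eq]; exact hc)] at h
      by_contra hn
      rw [if_neg hn] at h
      exact absurd h (by decide)
    · refine ih ?_ ho
      split_ifs at h <;> exact h

/-- Soundness of the search. `B` encodes an actual configuration, with the digits `i` such that `i /
s = n` belonging to step `n`, and `κ` bounds its costs. It traces a path through the search tree
that is never cut off, so `ok` holds for its code `m`. Steps run downwards, so conditions in `on`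
concern greater numbers. -/
theorem exists_ok_of_search {ok : ℕ → Bool} {row : ℕ → List Branch} {s N lim : ℕ} {B : ℕ → Prop}
    {κ : ℕ → ℕ} (hs : search ok (rowsFrom row N) 0 lim = true)
    (h : ∀ n < N, ∃ set c on off, branch set c on off ∈ row n ∧ c ≤ κ n ∧
      (∀ i, i / s = n → (B i ↔ i ∈ set)) ∧ (∀ i ∈ set, i / s = n) ∧
      (∀ i ∈ on, B i ∧ n < i / s ∧ i / s < N) ∧ ∀ i ∈ off, ¬ B i)
    (hκ : ∑ n ∈ Finset.range N, κ n ≤ lim) :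
    ∃ m, ok m = true ∧ ∀ i, i / s < N → (m.testBit i = true ↔ B i) := by
  have aux : ∀ n ≤ N, ∀ m c, (∀ i, m.testBit i = true ↔ B i ∧ n ≤ i / s ∧ i / s < N) →
      ∑ n ∈ Finset.range n, κ n ≤ c → search ok (rowsFrom row n) m c = true →
      ∃ m, ok m = true ∧ ∀ i, i / s < N → (m.testBit i = true ↔ B i) := by
    intro n
    induction n with
    | zero =>
      intro _ m c hm _ hs
      exact ⟨m, hs, fun i hi => by simp [hm, hi]⟩
    | succ n ih =>
      intro hn m c hm hc hs
      obtain ⟨set, c₀, on, off, hrow, hc₀, hset, hset', hon, hoff⟩ := h n (by omega)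
      rw [Finset.sum_range_succ] at hc
      -- A single masked comparison tests that all of `on` and none of `off` is set.
      have hland : m &&& bitsOf (on ++ off) = bitsOf on := by
        refine Nat.eq_of_testBit_eq fun i => ?_
        rw [Nat.testBit_and, Bool.eq_iff_iff, Bool.and_eq_true, testBit_bitsOf, testBit_bitsOf,
          List.mem_append, hm]
        constructor
        · rintro ⟨h1, h2 | h2⟩
          · exact h2
          · exact absurd h1.1 (hoff i h2)
        · intro h1
          obtain ⟨h2, h3, h4⟩ := hon i h1
          exact ⟨⟨h2, h3, h4⟩, Or.inl h1⟩
      refine ih (by omega) _ _ ?_ ?_ (next_of_tryAll (c := c) hs hrow hland ?_)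
      · intro i
        change (m ||| bitsOf set).testBit i = true ↔ _
        rw [Nat.testBit_or, Bool.or_eq_true, testBit_bitsOf, hm]
        constructor
        · rintro (h1 | h1)
          · exact ⟨h1.1, by omega, h1.2.2⟩
          · have h2 := hset' i h1
            exact ⟨(hset i h2).2 h1, by omega, by omega⟩
        · rintro ⟨h1, h2, h3⟩
          rcases Nat.eq_or_lt_of_le h2 with h2 | h2
          · exact Or.inr ((hset i h2.symm).1 h1)
          · exact Or.inl ⟨h1, h2, h3⟩
      · change _ ≤ c - c₀
        omega
      · change c₀ ≤ c
        omega
  exact aux N le_rfl 0 lim (fun i => by simp) hκ hs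

/-- The darts from `n` to greater vertices. -/
def upward (d : ℕ) (nb : ℕ → ℕ → ℕ) (n : ℕ) : List ℕ :=
  (List.range d).filter fun k => Nat.blt n (nb n k)

theorem mem_upward {d : ℕ} {nb : ℕ → ℕ → ℕ} {n k : ℕ} :
    k ∈ upward d nb n ↔ k < d ∧ n < nb n k := by
  rw [upward, List.mem_filter, List.mem_range, Nat.blt_eq]

/-- All ways to divide a list into two. -/
def splits : List ℕ → List (List ℕ × List ℕ)
  | [] => [([], [])]
  | a :: l => (splits l).map (fun p => (a :: p.1, p.2)) ++ (splits l).map fun p => (p.1, a :: p.2)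

theorem filter_mem_splits (p : ℕ → Bool) (l : List ℕ) :
    (l.filter p, l.filter fun a => !p a) ∈ splits l := by
  induction l with
  | nil => simp [splits]
  | cons a l ih =>
    rw [splits, List.mem_append, List.mem_map, List.mem_map]
    by_cases h : p a = true
    · exact Or.inl ⟨_, ih, by simp [h]⟩
    · exact Or.inr ⟨_, ih, by simp [h]⟩

/-- The branches for the side of `n` in an edge cut, the cost being the weight of the edges from
`n` to greater vertices on the other side. -/
def cutRow (d : ℕ) (nb : ℕ → ℕ → ℕ) (wt : ℕ → ℕ) (n : ℕ) : List Branch :=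
  (splits (upward d nb n)).map
      (fun p => branch [n] (p.2.map wt).sum (p.1.map (nb n)) (p.2.map (nb n))) ++
    (splits (upward d nb n)).map
      fun p => branch [] (p.1.map wt).sum (p.1.map (nb n)) (p.2.map (nb n))

/-- Fewer than `t` of the first `N` digits of `m` are 1, or fewer than `t` are 0. -/
def smallSide (N t m : ℕ) : Bool :=
  Nat.blt ((List.range N).map fun v => bif m.testBit v then 1 else 0).sum t ||
    Nat.blt ((List.range N).map fun v => bif !m.testBit v then 1 else 0).sum t

theorem sum_map_range_eq (n : ℕ) (p : ℕ → Bool) :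
    ((List.range n).map fun k => bif p k then 1 else 0).sum =
      (Finset.univ.filter fun k : Fin n => p k = true).card := by
  have : ((List.range n).map fun k => bif p k then 1 else 0).sum =
      ∑ k ∈ Finset.range n, (bif p k then 1 else 0) := rfl
  rw [this, Finset.sum_range, Finset.card_filter]
  refine Finset.sum_congr rfl fun k _ => ?_
  cases p k <;> rfl

theorem sum_map_filter_range_eq (n : ℕ) (p : ℕ → Bool) (w : ℕ → ℕ) :
    (((List.range n).filter p).map w).sum = ∑ k : Fin n, if p k = true then w k else 0 := by
  have : ∀ l : List ℕ, ((l.filter p).map w).sum =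
      (l.map fun k => if p k = true then w k else 0).sum := by
    intro l
    induction l with
    | nil => rfl
    | cons a l ih => by_cases h : p a = true <;> simp [h, ih]
  rw [this, ← Finset.sum_range fun k => if p k = true then w k else 0]
  rfl

variable {lim N d : ℕ} {nb : ℕ → ℕ → ℕ} {r : Fin N × Fin d → Fin N × Fin d}

/-- The edge cuts with at least `t` vertices on both sides have a weight greater than `lim`. -/
theorem lt_weight_cut {t : ℕ} {wt : ℕ → ℕ} (hr : ∀ x, r (r x) = x)
    (hnb : ∀ x, nb x.1 x.2 = (r x).1) (hwt : ∀ x, wt (r x).2 = wt x.2)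
    (hs : search (smallSide N t) (rowsFrom (cutRow d nb wt) N) 0 lim = true) (X : Finset (Fin N))
    (h1 : t ≤ X.card) (h2 : t ≤ Xᶜ.card) :
    lim < ∑ x with x.1 ∈ X ∧ (r x).1 ∉ X, wt x.2 := by
  classical
  by_contra! hlim
  let f : ℕ → Bool := fun v => decide (∃ h : v < N, ⟨v, h⟩ ∈ X)
  have hf : ∀ v : Fin N, f v = true ↔ v ∈ X := fun v => by simp [f]
  -- Each edge of the cut is charged to its lesser end.
  let κ : ℕ → ℕ := fun n => (((upward d nb n).filter fun k => f (nb n k) != f n).map wt).sum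
  have hex : ∃ m, smallSide N t m = true ∧
      ∀ i, i / 1 < N → (m.testBit i = true ↔ f i = true) := by
    refine exists_ok_of_search (κ := κ) hs ?_ ?_
    · intro n hn
      have hsplit := filter_mem_splits (fun k => f (nb n k)) (upward d nb n)
      have hon : ∀ i ∈ ((upward d nb n).filter fun k => f (nb n k)).map (nb n),
          f i = true ∧ n < i / 1 ∧ i / 1 < N := by
        intro i hi
        obtain ⟨k, hk, rfl⟩ := List.mem_map.1 hi
        rw [List.mem_filter, mem_upward] at hk
        rw [Nat.div_one, hnb (⟨n, hn⟩, ⟨k, hk.1.1⟩)] at *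
        exact ⟨hk.2, hk.1.2, Fin.isLt _⟩
      have hoff : ∀ i ∈ ((upward d nb n).filter fun k => !f (nb n k)).map (nb n), ¬ f i = true := by
        intro i hi
        obtain ⟨k, hk, rfl⟩ := List.mem_map.1 hi
        rw [List.mem_filter] at hk
        simpa using hk.2
      cases hfn : f n with
      | true =>
        refine ⟨[n], _, _, _, List.mem_append_left _ (List.mem_map.2 ⟨_, hsplit, rfl⟩), ?_, ?_, ?_,
          hon, hoff⟩
        · simp [κ, hfn]
        · rintro i rfl
          simpa using hfn
        · simp
      | false =>
        refine ⟨[], _, _, _, List.mem_append_right _ (List.mem_map.2 ⟨_, hsplit, rfl⟩), ?_, ?_, ?_,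
          hon, hoff⟩
        · simp [κ, hfn]
        · rintro i rfl
          simpa using hfn
        · simp
    · have h3 : ∑ i ∈ Finset.range N, κ i =
          ∑ x : Fin N × Fin d with x.1 < (r x).1 ∧ ¬ ((r x).1 ∈ X ↔ x.1 ∈ X), wt x.2 := by
        rw [Finset.sum_range, Finset.sum_filter, Fintype.sum_prod_type]
        refine Finset.sum_congr rfl fun n _ => ?_
        simp only [κ, upward]
        rw [List.filter_filter, sum_map_filter_range_eq]
        refine Finset.sum_congr rfl fun k _ => if_congr ?_ rfl rfl
        rw [Bool.and_eq_true, Nat.blt_eq, hnb (n, k), bne_iff_ne, ne_eq, Bool.eq_iff_iff, hf, hf,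
          Fin.lt_def, and_comm]
      rw [h3]
      let A : Finset (Fin N × Fin d) :=
        Finset.univ.filter fun x => x.1 < (r x).1 ∧ ¬ ((r x).1 ∈ X ↔ x.1 ∈ X)
      have hA : ∀ x, x ∈ A ↔ x.1 < (r x).1 ∧ ¬ ((r x).1 ∈ X ↔ x.1 ∈ X) := fun x => by simp [A]
      -- Reorients the edges of the cut so that they leave `X`.
      let φ : Fin N × Fin d → Fin N × Fin d := fun x => if x.1 ∈ X then x else r x
      have hφ : Set.InjOn φ A := by
        intro x hx y hy hxy
        rw [Finset.mem_coe, hA] at hx hy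
        simp only [φ] at hxy
        split_ifs at hxy with h h' h'
        · exact hxy
        · rw [hxy, hr] at hx
          exact absurd hx.1 (not_lt.2 hy.1.le)
        · rw [← hxy, hr] at hy
          exact absurd hy.1 (not_lt.2 hx.1.le)
        · rw [← hr x, hxy, hr]
      have h4 : ∑ x ∈ A, wt x.2 = ∑ x ∈ A.image φ, wt x.2 := by
        rw [Finset.sum_image hφ]
        refine Finset.sum_congr rfl fun x _ => ?_
        simp only [φ]
        split_ifs
        · rfl
        · exact (hwt x).symm
      change ∑ x ∈ A, wt x.2 ≤ lim
      rw [h4]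
      refine le_trans (Finset.sum_le_sum_of_subset ?_) hlim
      intro y hy
      obtain ⟨x, hx, rfl⟩ := Finset.mem_image.1 hy
      rw [hA] at hx
      simp only [φ, Finset.mem_filter, Finset.mem_univ, true_and]
      split_ifs with h
      · exact ⟨h, by tauto⟩
      · rw [hr]
        exact ⟨by tauto, h⟩
  obtain ⟨m, hm, hmf⟩ := hex
  have hmX : ∀ v : Fin N, m.testBit v = true ↔ v ∈ X := fun v => by
    rw [hmf v (by rw [Nat.div_one]; exact v.isLt), hf]
  rw [smallSide, sum_map_range_eq, sum_map_range_eq, Bool.or_eq_true, Nat.blt_eq, Nat.blt_eq] at hm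
  have e1 : (Finset.univ.filter fun v : Fin N => m.testBit v = true) = X := by
    ext v
    simp [hmX]
  have e2 : (Finset.univ.filter fun v : Fin N => (!m.testBit v) = true) = Xᶜ := by
    ext v
    rw [Finset.mem_filter, Bool.not_eq_true', ← Bool.not_eq_true, hmX, Finset.mem_compl]
    simp
  rw [e1, e2] at hm
  omega

/-- The branches for the vertex `n` when at cost 1 it may be deleted, and otherwise is put into one
of two classes, which must not be adjacent. -/
def separatorRow (d : ℕ) (nb : ℕ → ℕ → ℕ) (n : ℕ) : List Branch :=
  [branch [] 1 [] [], branch [2 * n] 0 [] ((upward d nb n).map fun k => 2 * nb n k + 1),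
    branch [2 * n + 1] 0 [] ((upward d nb n).map fun k => 2 * nb n k)]

/-- One of the two classes is empty. -/
def emptyClass (N m : ℕ) : Bool :=
  Nat.beq (m &&& bitsOf ((List.range N).map fun v => 2 * v)) 0 ||
    Nat.beq (m &&& bitsOf ((List.range N).map fun v => 2 * v + 1)) 0

/-- Deleted vertices cost 1, so the budget `lim` allows all separators of at most `lim` vertices;
the search finds that one of the two classes is always empty. -/
theorem noSeparator_of_search (hr : ∀ x, r (r x) = x) (hnb : ∀ x, nb x.1 x.2 = (r x).1)
    (hs : search (emptyClass N) (rowsFrom (separatorRow d nb) N) 0 lim = true) :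
    NoSeparator r (lim + 1) := by
  classical
  intro S P hS hP u v hu hv hPu
  by_contra hPv
  -- 0 means deleted, 1 and 2 are the sides of `P`. An edge between the sides is recognised by the
  -- sum 3.
  let F : Fin N → ℕ := fun v => if v ∈ S then 0 else if P v then 1 else 2
  let f : ℕ → ℕ := fun v => if h : v < N then F ⟨v, h⟩ else 0
  have hf : ∀ v : Fin N, f v = F v := fun v => by simp [f]
  have hF : ∀ v, F v = 0 ∨ F v = 1 ∨ F v = 2 := fun v => by
    simp only [F]
    split_ifs <;> simp
  have hadj : ∀ x, F x.1 + F (r x).1 = 3 → False := fun x hx => by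
    have h4 := hP x
    have h5 := hP (r x)
    rw [hr] at h5
    simp only [F] at hx
    split_ifs at hx <;> simp_all
  have hadj' : ∀ n < N, ∀ k ∈ upward d nb n, f n + f (nb n k) = 3 → False := fun n hn k hk => by
    rw [mem_upward] at hk
    rw [hnb (⟨n, hn⟩, ⟨k, hk.1⟩), hf, show f n = F ⟨n, hn⟩ from hf ⟨n, hn⟩]
    exact hadj (⟨n, hn⟩, ⟨k, hk.1⟩)
  have hex : ∃ m, emptyClass N m = true ∧
      ∀ i, i / 2 < N → (m.testBit i = true ↔ f (i / 2) = i % 2 + 1) := by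
    refine exists_ok_of_search (κ := fun n => if f n = 0 then 1 else 0) hs ?_ ?_
    · intro n hn
      have h3 := hF ⟨n, hn⟩
      rw [← hf] at h3
      change f n = 0 ∨ f n = 1 ∨ f n = 2 at h3
      rcases h3 with h3 | h3 | h3
      · refine ⟨[], 1, [], [], by simp [separatorRow], by simp [h3], ?_, by simp, by simp, by simp⟩
        rintro i rfl
        simp [h3]
      · refine ⟨[2 * n], 0, [], _, List.mem_cons_of_mem _ List.mem_cons_self, by simp, ?_, ?_,
          by simp, ?_⟩
        · rintro i rfl
          rw [h3, List.mem_singleton]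
          omega
        · simp
        · intro i hi
          obtain ⟨k, hk, rfl⟩ := List.mem_map.1 hi
          refine fun h => hadj' n hn k hk ?_
          rw [show (2 * nb n k + 1) / 2 = nb n k by omega] at h
          omega
      · refine ⟨[2 * n + 1], 0, [], _,
          List.mem_cons_of_mem _ (List.mem_cons_of_mem _ List.mem_cons_self), by simp, ?_, ?_,
          by simp, ?_⟩
        · rintro i rfl
          rw [h3, List.mem_singleton]
          omega
        · intro i hi
          rw [List.mem_singleton] at hi
          omega
        · intro i hi
          obtain ⟨k, hk, rfl⟩ := List.mem_map.1 hi
          refine fun h => hadj' n hn k hk ?_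
          rw [show 2 * nb n k / 2 = nb n k by omega] at h
          omega
    · have : ∑ n ∈ Finset.range N, (if f n = 0 then 1 else 0) = S.card := by
        rw [Finset.sum_range, ← Finset.card_filter]
        congr 1
        ext x
        simp only [Finset.mem_filter, Finset.mem_univ, true_and, hf, F]
        split_ifs <;> simp_all
      rw [this]
      omega
  obtain ⟨m, hm, hmf⟩ := hex
  have hland : ∀ (g : ℕ → ℕ) (w : Fin N),
      Nat.beq (m &&& bitsOf ((List.range N).map g)) 0 = true → m.testBit (g w) ≠ true := by
    intro g w h h'
    rw [Nat.beq_eq] at h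
    have h3 : (m &&& bitsOf ((List.range N).map g)).testBit (g w) = true := by
      rw [Nat.testBit_and, Bool.and_eq_true, testBit_bitsOf, List.mem_map]
      exact ⟨h', w, List.mem_range.2 w.isLt, rfl⟩
    rw [h, Nat.zero_testBit] at h3
    exact absurd h3 (by decide)
  rw [emptyClass, Bool.or_eq_true] at hm
  rcases hm with hm | hm
  · refine hland _ u hm ((hmf _ (by have := u.isLt; omega)).2 ?_)
    rw [show 2 * (u : ℕ) / 2 = u by omega, hf]
    simp [F, hu, hPu]
  · refine hland _ v hm ((hmf _ (by have := v.isLt; omega)).2 ?_)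
    rw [show (2 * (v : ℕ) + 1) / 2 = v by omega, hf]
    simp only [F, hv, hPv, if_false]
    omega

end Search

/-! ### Counting orbits by least representatives. -/

section OrbitRep

/-- The element of least key among `x, φ x, …, φ^n x`. -/
def orbitRep {α : Type*} (φ : α → α) (key : α → ℕ) : ℕ → α → α
  | 0, x => x
  | n + 1, x => if key x ≤ key (orbitRep φ key n (φ x)) then x else orbitRep φ key n (φ x)

theorem orbitRep_prop {α : Type*} {φ : α → α} {key : α → ℕ} {P : α → Prop}
    (hP : ∀ x, P (φ x) ↔ P x) (n : ℕ) (x : α) : P (orbitRep φ key n x) ↔ P x := by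
  induction n generalizing x with
  | zero => rfl
  | succ n ih =>
    rw [orbitRep]
    split_ifs
    · rfl
    · rw [ih, hP]

/-- By `h1` the representative is constant on orbits, hence idempotent, and its fixed points
correspond to the orbits. With distinct keys it suffices that no orbit has more than `n + 1`
elements. -/
theorem card_orbits_eq {α : Type*} [Fintype α] [DecidableEq α] {φ : α → α} {key : α → ℕ} {n k : ℕ}
    (h1 : ∀ x, orbitRep φ key n (φ x) = orbitRep φ key n x)
    (h2 : (Finset.univ.filter fun x => orbitRep φ key n x = x).card = k) :
    Nat.card (Orbits φ) = k := by
  have h3 : ∀ x, orbitRep φ key n (orbitRep φ key n x) = orbitRep φ key n x := fun x =>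
    (orbitRep_prop (P := fun y => orbitRep φ key n y = orbitRep φ key n x)
      (fun y => by rw [h1]) n x).2 rfl
  rw [card_orbits φ (fun x => (⟨orbitRep φ key n x, h3 x⟩ : {x // orbitRep φ key n x = x}))
    (fun x => ⟨x, Subtype.ext x.2⟩) (fun x => Subtype.ext (h1 x)), Nat.card_eq_fintype_card,
    Fintype.card_subtype, h2]
  intro P hP x y hxy hx
  have := congrArg Subtype.val hxy
  simp only at this
  rwa [← orbitRep_prop hP n y, ← this, orbitRep_prop hP n x]

end OrbitRep

/-! ### Numerical data, one byte per dart. -/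

section Tables

/-- The vertices at which the darts 1 and 2 are coloured in exchanged order. -/
def grinbergColours : ℕ :=
  9336686418192

/-- The darts of Grinberg's graph: `3 * v + k` stands for the `k`-th dart at `v`. -/
def grinbergTable : ℕ :=
  106510094419221189024872148959261600034508832400234648744092978272508882941477868479424800443272621680622840423168448079157267698736095613228069049072733909586436336991911496874698686150138970356468490189733588277198712134563612784687954338361476633012500975179296453934713266909653780486303274258210686924081678946883063044402579203

/-- An edge colouring of the icosahedron. -/
def icoColours : ℕ :=
  252555909496422706662392206437525156900349580098684552

/-- The darts of the icosahedron: `5 * v + k` stands for the `k`-th dart at `v`. -/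
def icoTable : ℕ :=
  367504577511147085006092407968590473831624552842250033370250668051279435593681323990133562341730707949416490238524906653721754799722731500669445

/-- The entry for the `k`-th dart at the vertex `v` in the table `T`. -/
def tableCode (T d v k : ℕ) : ℕ := (T >>> (8 * (d * v + k))) % 256

/-- The head of a dart according to the table `T`. -/
def tableHead (T d v k : ℕ) : ℕ := tableCode T d v k / d

/-- The dart reversal given by the table `T`. -/
def tableMap (T : ℕ) {n d : ℕ} [NeZero n] [NeZero d] (x : Fin n × Fin d) : Fin n × Fin d :=
  (Fin.ofNat n (tableHead T d x.1 x.2), Fin.ofNat d (tableCode T d x.1 x.2 % d))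

theorem isDartMap_of_decide {n d : ℕ} {r : Fin n × Fin d → Fin n × Fin d}
    (h : (∀ x, r (r x) = x) ∧ (∀ x, (r x).1 ≠ x.1) ∧
      ∀ v i j, (r (v, i)).1 = (r (v, j)).1 → i = j) : IsDartMap r :=
  ⟨h.1, h.2.1, h.2.2⟩

end Tables

/-! ### The icosahedron, start of the family. -/

section Icosahedron

/-- The dart reversal of the icosahedron. -/
def icosahedron : Fin 12 × Fin 5 → Fin 12 × Fin 5 :=
  tableMap icoTable

theorem isDartMap_icosahedron : IsDartMap icosahedron :=
  isDartMap_of_decide (by decide +kernel)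

theorem noSeparator_icosahedron : NoSeparator icosahedron 5 :=
  noSeparator_of_search (lim := 4) (nb := tableHead icoTable 5) isDartMap_icosahedron.invol
    (by decide +kernel) (by decide +kernel)

theorem isQuintic_icosahedron : IsQuintic icosahedron 0 11 where
  toIsDartMap := isDartMap_icosahedron
  euler := by
    rw [card_orbits_eq (key := fun x => 5 * x.1.val + x.2.val) (n := 2) (k := 20)
      (by decide +kernel) (by decide +kernel), Fintype.card_fin]
  noSep := noSeparator_icosahedron
  colour := by
    refine ⟨fun x => Fin.ofNat 5 (icoColours >>> (3 * (5 * x.1.val + x.2.val)) % 8), ?_, ?_⟩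
    · decide +kernel
    · unfold Function.Injective
      decide +kernel
  large := by rw [Fintype.card_fin]; norm_num
  ne := by decide +kernel
  far := by decide +kernel
  triangle_left := by decide +kernel
  triangle_right := by decide +kernel

end Icosahedron

/-! ### Grinberg's graph: connectivity, planarity, perfect matchings. -/

section GrinbergGraph

/-- The dart reversal of Grinberg's cubic graph with 46 vertices, whose faces are 21 pentagons,
3 octagons and a nonagon. The darts with number 0 form a 1-factor. -/
def grinberg : Fin 46 × Fin 3 → Fin 46 × Fin 3 :=
  tableMap grinbergTable

theorem isDartMap_grinberg : IsDartMap grinberg :=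
  isDartMap_of_decide (by decide +kernel)

theorem tableHead_grinberg (x : Fin 46 × Fin 3) :
    tableHead grinbergTable 3 x.1 x.2 = (grinberg x).1 := by
  revert x
  decide +kernel

theorem noSeparator_grinberg : NoSeparator grinberg 3 :=
  noSeparator_of_search (lim := 2) isDartMap_grinberg.invol tableHead_grinberg (by decide +kernel)

/-- For cyclic edge connectivity: a side that contains a cycle has at least three vertices. -/
theorem cut_grinberg (X : Finset (Fin 46)) (h1 : 3 ≤ X.card) (h2 : 3 ≤ Xᶜ.card) :
    4 < (Finset.univ.filter fun x => x.1 ∈ X ∧ (grinberg x).1 ∉ X).card := by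
  have := lt_weight_cut (lim := 4) (wt := fun _ => 1) isDartMap_grinberg.invol tableHead_grinberg
    (fun _ => rfl) (by decide +kernel) X h1 h2
  rwa [Finset.card_eq_sum_ones]

/-- A 3-edge-colouring. -/
def grinbergColouring (x : Fin 46 × Fin 3) : Fin 3 :=
  if x.2 = 0 then 0 else if grinbergColours >>> x.1.val % 2 = 0 then x.2 else -x.2

theorem isDartColouring_grinberg : IsDartColouring grinberg grinbergColouring where
  rev := by decide +kernel
  inj := by
    unfold Function.Injective
    decide +kernel

theorem card_orbits_grinberg : Nat.card (Orbits (faceStep grinberg)) = 25 :=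
  card_orbits_eq (key := fun x => 3 * x.1.val + x.2.val) (n := 8)
    (by decide +kernel) (by decide +kernel)

theorem isPlanar_grinberg : IsPlanar (dartGraph grinberg isDartMap_grinberg) := by
  refine isPlanar_dartGraph _
    (connected_dartGraph _ (by rw [Fintype.card_fin]; norm_num) (by norm_num)
      noSeparator_grinberg) ?_
  rw [card_orbits_grinberg, Fintype.card_fin]

/-- The branches for the number of the dart at `n` that belongs to a perfect matching. -/
def matchingRow (n : ℕ) : List Branch :=
  (List.range 3).map fun l => branch [3 * n + l] 0
    (((upward 3 (tableHead grinbergTable 3) n).filter fun k => Nat.beq k l).map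
      (tableCode grinbergTable 3 n))
    (((upward 3 (tableHead grinbergTable 3) n).filter fun k => !Nat.beq k l).map
      (tableCode grinbergTable 3 n))

/-- The dart after the dart `e` on a walk that avoids the darts in `m`; both are directed
backwards. -/
def walkStep (m e : ℕ) : ℕ :=
  (grinbergTable >>> (8 * (bif m.testBit (e / 3 * 3 + (e + 1) % 3) then e / 3 * 3 + (e + 2) % 3
    else e / 3 * 3 + (e + 1) % 3))) % 256

/-- Whether the walk from `e` reaches `e₀` in at most `n` steps. -/
def closedWalk (m e₀ n : ℕ) : ℕ → Bool :=
  Nat.rec (fun _ => false) (fun _ ih e =>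
    (fun e' => choose (Nat.beq e' e₀) true (ih e')) (walkStep m e)) n

/-- The component of the vertex 0 in the complement of the matching `m` is too small. -/
def hasShortCycle (m : ℕ) : Bool := closedWalk m (m % 2) 45 (m % 2)

theorem exists_iterate_of_closedWalk {m e₀ n e : ℕ} (h : closedWalk m e₀ n e = true) :
    ∃ i, 1 ≤ i ∧ i ≤ n ∧ (walkStep m)^[i] e = e₀ := by
  induction n generalizing e with
  | zero => exact absurd h Bool.false_ne_true
  | succ n ih =>
    change choose (Nat.beq (walkStep m e) e₀) true (closedWalk m e₀ n (walkStep m e)) = true at h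
    rw [choose_eq] at h
    split_ifs at h with h'
    · rw [Nat.beq_eq] at h'
      exact ⟨1, le_rfl, by omega, h'⟩
    · obtain ⟨i, h1, h2, h3⟩ := ih h
      exact ⟨i + 1, by omega, by omega, h3⟩

/-- For every perfect matching, the cycle through vertex 0 in the complementary 2-factor closes
within 45 steps, so it misses one of the 46 vertices. Branches are free, hence the budget 0. -/
theorem search_matching : search hasShortCycle (rowsFrom matchingRow 46) 0 0 = true := by
  decide +kernel

/-- A number for every dart. -/
def dartIndex (x : Fin 46 × Fin 3) : ℕ := 3 * x.1 + x.2

theorem tableCode_grinberg (x : Fin 46 × Fin 3) :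
    tableCode grinbergTable 3 x.1 x.2 = dartIndex (grinberg x) := by
  revert x
  decide +kernel

theorem dartIndex_injective : Function.Injective dartIndex := by
  rintro ⟨⟨v, hv⟩, ⟨i, hi⟩⟩ ⟨⟨w, hw⟩, ⟨j, hj⟩⟩ h
  simp only [dartIndex] at h
  simp only [Prod.mk.injEq, Fin.mk.injEq]
  omega

/-- The dart after a dart on a walk that avoids the matching `o`; both are directed backwards. -/
def nextDart (o : Fin 46 → Fin 3) (x : Fin 46 × Fin 3) : Fin 46 × Fin 3 :=
  grinberg (x.1, if o x.1 = x.2 + 1 then x.2 + 2 else x.2 + 1)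

theorem walkStep_dartIndex {o : Fin 46 → Fin 3} {m : ℕ}
    (hm : ∀ v k, m.testBit (dartIndex (v, k)) = true ↔ o v = k) (x : Fin 46 × Fin 3) :
    walkStep m (dartIndex x) = dartIndex (nextDart o x) := by
  obtain ⟨v, k⟩ := x
  have h1 : dartIndex (v, k) / 3 * 3 + (dartIndex (v, k) + 1) % 3 = dartIndex (v, k + 1) := by
    simp only [dartIndex, Fin.val_add, Fin.val_one]
    omega
  have h2 : dartIndex (v, k) / 3 * 3 + (dartIndex (v, k) + 2) % 3 = dartIndex (v, k + 2) := by
    simp only [dartIndex, Fin.val_add, Fin.val_two]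
    omega
  rw [nextDart, ← tableCode_grinberg, walkStep, h1, h2, tableCode]
  by_cases h : o v = k + 1
  · rw [(hm _ _).2 h, cond_true, if_pos h]
    rfl
  · rw [Bool.eq_false_iff.2 ((hm _ _).not.2 h), cond_false, if_neg h]
    rfl

/-- Deleting a perfect matching leaves a disconnected graph. -/
theorem exists_proper_closed (o : Fin 46 → Fin 3)
    (ho : ∀ w, (grinberg (w, o w)).2 = o (grinberg (w, o w)).1) :
    ∃ Q : Fin 46 → Prop, (∃ w, Q w) ∧ (∃ w, ¬ Q w) ∧
      ∀ x, x.2 ≠ o x.1 → Q x.1 → Q (grinberg x).1 := by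
  let f : ℕ → ℕ := fun v => if h : v < 46 then o ⟨v, h⟩ else 0
  have hf : ∀ v : Fin 46, f v = o v := fun v => by simp [f]
  -- The matching contains a dart exactly if it contains its reverse.
  have hcode : ∀ x : Fin 46 × Fin 3, f (dartIndex (grinberg x) / 3) = dartIndex (grinberg x) % 3 ↔
      x.2 = o x.1 := by
    intro x
    have h1 : dartIndex (grinberg x) / 3 = (grinberg x).1 := by
      simp only [dartIndex]
      omega
    have h2 : dartIndex (grinberg x) % 3 = (grinberg x).2 := by
      simp only [dartIndex]
      omega
    rw [h1, h2, hf]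
    constructor
    · intro h
      have h3 := ho (grinberg x).1
      rw [Fin.ext h, Prod.mk.eta, isDartMap_grinberg.invol] at h3
      exact h3
    · intro h
      have h3 := ho x.1
      rw [← h, Prod.mk.eta] at h3
      exact congrArg Fin.val h3.symm
  have hex : ∃ m, hasShortCycle m = true ∧
      ∀ i, i / 3 < 46 → (m.testBit i = true ↔ f (i / 3) = i % 3) := by
    refine exists_ok_of_search (κ := fun _ => 0) search_matching ?_ (by simp)
    intro n hn
    have hfn : f n = o ⟨n, hn⟩ := hf ⟨n, hn⟩
    have hlt : f n < 3 := by
      rw [hfn]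
      exact Fin.isLt _
    refine ⟨[3 * n + f n], 0, _, _, List.mem_map.2 ⟨f n, List.mem_range.2 hlt, rfl⟩, le_rfl, ?_, ?_,
      ?_, ?_⟩
    · rintro i rfl
      rw [List.mem_singleton]
      omega
    · intro i hi
      rw [List.mem_singleton] at hi
      omega
    · intro i hi
      obtain ⟨k, hk, rfl⟩ := List.mem_map.1 hi
      rw [List.mem_filter, mem_upward, Nat.beq_eq] at hk
      have h1 := tableCode_grinberg (⟨n, hn⟩, ⟨k, hk.1.1⟩)
      have h2 := tableHead_grinberg (⟨n, hn⟩, ⟨k, hk.1.1⟩)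
      have h3 := hk.1.2
      simp only [tableHead] at h1 h2 h3
      rw [h1] at h2 h3 ⊢
      refine ⟨(hcode _).2 (Fin.ext (hk.2.trans hfn)), h3, ?_⟩
      rw [h2]
      exact Fin.isLt _
    · intro i hi
      obtain ⟨k, hk, rfl⟩ := List.mem_map.1 hi
      rw [List.mem_filter, mem_upward, Bool.not_eq_true', ← Bool.not_eq_true, Nat.beq_eq] at hk
      have h1 := tableCode_grinberg (⟨n, hn⟩, ⟨k, hk.1.1⟩)
      simp only at h1
      rw [h1, hcode]
      exact fun h => hk.2 ((congrArg Fin.val h).trans hfn.symm)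
  obtain ⟨m, hm, hmf⟩ := hex
  have hmo : ∀ v k, m.testBit (dartIndex (v, k)) = true ↔ o v = k := by
    intro v k
    have h1 : dartIndex (v, k) / 3 = v := by
      simp only [dartIndex]
      omega
    have h2 : dartIndex (v, k) % 3 = k := by
      simp only [dartIndex]
      omega
    rw [hmf _ (by rw [h1]; exact v.isLt), h1, h2, hf, Fin.ext_iff]
  -- Digit 0 of `m` tells whether dart 0 at vertex 0 is in the matching, so dart number `m % 2`
  -- there is not.
  obtain ⟨x₀, hx₀, hx₀'⟩ : ∃ x : Fin 46 × Fin 3, dartIndex x = m % 2 ∧ x.2 ≠ o x.1 := by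
    have h0 := hmo 0 0
    have h3 : m.testBit (dartIndex (0, 0)) = true ↔ m % 2 = 1 := by
      rw [show dartIndex (0, 0) = 0 from rfl, Nat.testBit_zero, decide_eq_true_iff]
    rw [h3] at h0
    rcases Nat.mod_two_eq_zero_or_one m with h | h
    · exact ⟨(0, 0), h.symm, fun h' => by rw [h0.2 h'.symm] at h; exact absurd h (by decide)⟩
    · exact ⟨(0, 1), h.symm, fun h' => by
        rw [h0.1 h] at h'
        exact absurd h' (by decide)⟩
  obtain ⟨L, hL1, hL2, hL⟩ := exists_iterate_of_closedWalk hm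
  have hiter : ∀ i x, (walkStep m)^[i] (dartIndex x) = dartIndex ((nextDart o)^[i] x) := by
    intro i
    induction i with
    | zero => exact fun _ => rfl
    | succ i ih =>
      intro x
      rw [Function.iterate_succ_apply, Function.iterate_succ_apply, walkStep_dartIndex hmo, ih]
  rw [← hx₀, hiter] at hL
  have hper := dartIndex_injective hL
  have hmod : ∀ i, (nextDart o)^[i] x₀ = (nextDart o)^[i % L] x₀ := fun i =>
    ((Function.IsPeriodicPt.iterate_mod_apply (show Function.IsPeriodicPt (nextDart o) L x₀ from hper)
      i)).symm
  have havoid : ∀ i, ((nextDart o)^[i] x₀).2 ≠ o ((nextDart o)^[i] x₀).1 := by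
    intro i
    induction i with
    | zero => exact hx₀'
    | succ i ih =>
      rw [Function.iterate_succ_apply']
      generalize (nextDart o)^[i] x₀ = x at ih
      intro h
      have h3 := ho (nextDart o x).1
      rw [← h, Prod.mk.eta, nextDart, isDartMap_grinberg.invol] at h3
      simp only at h3
      have key : ∀ a b : Fin 3, (if a = b + 1 then b + 2 else b + 1) = a → False := by decide
      exact key _ _ h3
  have hthird : ∀ a b c : Fin 3, b ≠ a → c ≠ a → c ≠ b →
      c = if a = b + 1 then b + 2 else b + 1 := by decide
  -- `Q` is the vertex set of the closed walk, which has at most 45 elements.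
  refine ⟨fun w => ∃ i, ((nextDart o)^[i] x₀).1 = w, ⟨x₀.1, 0, rfl⟩, ?_, ?_⟩
  · by_contra! hall
    have h1 : (Finset.univ : Finset (Fin 46)) ⊆
        (Finset.range L).image fun i => ((nextDart o)^[i] x₀).1 := by
      intro w _
      obtain ⟨i, hi⟩ := hall w
      exact Finset.mem_image.2 ⟨i % L, Finset.mem_range.2 (Nat.mod_lt _ hL1), by rw [← hmod, hi]⟩
    have h2 := (Finset.card_le_card h1).trans Finset.card_image_le
    rw [Finset.card_univ, Fintype.card_fin, Finset.card_range] at h2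
    omega
  · rintro ⟨w, k⟩ hk ⟨i, hi⟩
    simp only at hi hk
    by_cases h : k = ((nextDart o)^[i] x₀).2
    -- The dart pointing backwards leads to the predecessor, which by periodicity is reached `L - 1`
    -- steps later; any other dart outside the matching leads to the successor.
    · obtain ⟨i', hi'⟩ : ∃ i', nextDart o ((nextDart o)^[i'] x₀) = (nextDart o)^[i] x₀ := by
        refine ⟨i + (L - 1), ?_⟩
        rw [← Function.iterate_succ_apply' (nextDart o), hmod,
          show (i + (L - 1)).succ = i + L by omega, Nat.add_mod_right, ← hmod]
      refine ⟨i', ?_⟩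
      have h1 : (w, k) = (nextDart o)^[i] x₀ := Prod.ext hi.symm h
      rw [h1, ← hi', nextDart, isDartMap_grinberg.invol]
    · refine ⟨i + 1, ?_⟩
      have h1 := havoid i
      rw [Function.iterate_succ_apply', nextDart]
      rw [hi] at h1 ⊢
      rw [← hthird _ _ _ h1 hk h]

/-- In a cubic graph the edges outside a hamiltonian cycle form a perfect matching. -/
theorem not_isHamiltonian_grinberg :
    ¬ (dartGraph grinberg isDartMap_grinberg).IsHamiltonian := by
  intro hH
  obtain ⟨a, p, hp⟩ := hH (by rw [Fintype.card_fin]; norm_num)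
  have hex : ∀ w, ∃ o : Fin 3, ∀ k, p.toSubgraph.Adj w (grinberg (w, k)).1 ↔ k ≠ o := by
    classical
    intro w
    have h1 := hp.isCycle.ncard_neighborSet_toSubgraph_eq_two (hp.mem_support w)
    have h2 : p.toSubgraph.neighborSet w = (fun k => (grinberg (w, k)).1) ''
        {k | p.toSubgraph.Adj w (grinberg (w, k)).1} := by
      ext v
      simp only [Subgraph.mem_neighborSet, Set.mem_image, Set.mem_ofPred_eq]
      constructor
      · intro h
        obtain ⟨k, rfl⟩ := p.toSubgraph.adj_sub h
        exact ⟨k, h, rfl⟩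
      · rintro ⟨k, h, rfl⟩
        exact h
    rw [h2, Set.ncard_image_of_injective _ (isDartMap_grinberg.simple w)] at h1
    have h3 := Set.ncard_add_ncard_compl {k | p.toSubgraph.Adj w (grinberg (w, k)).1}
    rw [h1, Nat.card_fin] at h3
    obtain ⟨o, ho⟩ := Set.ncard_eq_one.1
      (show {k | p.toSubgraph.Adj w (grinberg (w, k)).1}ᶜ.ncard = 1 by omega)
    refine ⟨o, fun k => ?_⟩
    have := Set.ext_iff.1 ho k
    simp only [Set.mem_compl_iff, Set.mem_ofPred_eq, Set.mem_singleton_iff] at this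
    rw [ne_eq, ← this, not_not]
  choose o ho using hex
  obtain ⟨Q, ⟨u, hu⟩, ⟨v, hv⟩, hQ⟩ := exists_proper_closed o fun w => by
    by_contra h
    have h1 := (ho (grinberg (w, o w)).1 (grinberg (w, o w)).2).2 h
    rw [Prod.mk.eta, isDartMap_grinberg.invol] at h1
    exact (ho w (o w)).1 h1.symm rfl
  refine hv (prop_of_isHamiltonianCycle hp Q ?_ u v hu)
  intro x y hxy hx
  obtain ⟨k, rfl⟩ := p.toSubgraph.adj_sub hxy
  exact hQ (x, k) ((ho x k).1 hxy) hx

/-- The component `X` of one cycle and its complement, which contains the other, have at least three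
vertices each, and all edges leaving `X` are among the deleted ones. -/
theorem isCyclicallyKEdgeConnected_grinberg :
    IsCyclicallyKEdgeConnected (dartGraph grinberg isDartMap_grinberg) 5 := by
  classical
  intro S hS u v p q hp hq
  by_contra hne
  let G := (dartGraph grinberg isDartMap_grinberg).deleteEdges S
  let X : Finset (Fin 46) := Finset.univ.filter fun w => G.Reachable u w
  have hthree : ∀ (a : Fin 46) (p : G.Walk a a), p.IsCycle → 3 ≤ p.support.toFinset.card := by
    intro a p hp
    have h1 := hp.three_le_length
    have h2 : p.support.tail.toFinset.card = p.support.tail.length :=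
      List.toFinset_card_of_nodup hp.support_nodup
    have h3 : p.support.tail.toFinset ⊆ p.support.toFinset := fun x hx => by
      rw [List.mem_toFinset] at hx ⊢
      exact List.mem_of_mem_tail hx
    have h4 := Finset.card_le_card h3
    rw [h2, List.length_tail, Walk.length_support] at h4
    omega
  have h1 : 3 ≤ X.card := (hthree u p hp).trans (Finset.card_le_card fun x hx => by
    rw [List.mem_toFinset] at hx
    simpa [X] using (p.takeUntil x hx).reachable)
  have h2 : 3 ≤ Xᶜ.card := (hthree v q hq).trans (Finset.card_le_card fun x hx => by
    rw [List.mem_toFinset] at hx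
    simp only [X, Finset.mem_compl, Finset.mem_filter, Finset.mem_univ, true_and]
    exact fun h => hne (h.trans (q.takeUntil x hx).reachable.symm))
  have h3 := cut_grinberg X h1 h2
  have h4 : ((Finset.univ.filter fun x => x.1 ∈ X ∧ (grinberg x).1 ∉ X).image
      fun x => s(x.1, (grinberg x).1) : Set (Sym2 (Fin 46))) ⊆ S := by
    intro e he
    simp only [Finset.coe_image, Set.mem_image, Finset.mem_coe, Finset.mem_filter,
      Finset.mem_univ, true_and] at he
    obtain ⟨x, ⟨hx1, hx2⟩, rfl⟩ := he
    by_contra he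
    apply hx2
    simp only [X, Finset.mem_filter, Finset.mem_univ, true_and] at hx1 ⊢
    refine hx1.trans (Adj.reachable ?_)
    exact deleteEdges_adj.2 ⟨⟨x.2, rfl⟩, he⟩
  have h5 := Set.encard_le_encard h4
  rw [Set.encard_coe_eq_coe_finsetCard, Finset.card_image_of_injOn] at h5
  · have h6 := lt_of_le_of_lt h5 hS
    have h7 : (Finset.univ.filter fun x => x.1 ∈ X ∧ (grinberg x).1 ∉ X).card < 5 := by
      exact_mod_cast h6
    omega
  · rintro ⟨a, i⟩ hx ⟨b, j⟩ hy hxy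
    simp only [Finset.coe_filter, Finset.mem_univ, true_and, Set.mem_ofPred_eq] at hx hy
    rw [Sym2.eq_iff] at hxy
    rcases hxy with ⟨rfl, h⟩ | ⟨h, -⟩
    · rw [isDartMap_grinberg.simple _ _ _ h]
    · rw [← h] at hy
      exact absurd hx.1 hy.2

end GrinbergGraph

/-! ### The doubled Grinberg graph is a frame. -/

section Doubled

/-- The number of the dart of `grinberg` that is doubled to the given dart. -/
def undouble (k : Fin 5) : Fin 3 := Fin.ofNat 3 ((k.val + 1) / 2)

/-- Grinberg's graph with the edges outside a 1-factor doubled. -/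
def doubledGrinberg (x : Fin 46 × Fin 5) : Fin 46 × Fin 5 :=
  let y := grinberg (x.1, undouble x.2)
  -- Parallel edges occur in opposite cyclic order at their two ends, so that they bound a digon.
  (y.1, if x.2 = 0 then 0 else if x.2.val % 2 = 1 then Fin.ofNat 5 (2 * y.2.val)
    else Fin.ofNat 5 (2 * y.2.val - 1))

theorem undouble_doubledGrinberg (x : Fin 46 × Fin 5) :
    undouble (doubledGrinberg x).2 = (grinberg (x.1, undouble x.2)).2 := by
  revert x
  decide +kernel

theorem doubledGrinberg_invol (x : Fin 46 × Fin 5) : doubledGrinberg (doubledGrinberg x) = x := by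
  revert x
  decide +kernel

theorem exists_undouble (k : Fin 3) : ∃ i, undouble i = k := by
  revert k
  decide

/-- A 5-edge-colouring of the doubled graph. -/
def doubledColouring (x : Fin 46 × Fin 5) : Fin 5 :=
  if x.2 = 0 then 0 else
    -- Colour class `c` splits into `2c` and `2c - 1`. Going to the other end of an edge exchanges
    -- both the parity of the dart and the order of the ends, so the comparison is the same at both.
    Fin.ofNat 5 (2 * (grinbergColouring (x.1, undouble x.2)).val -
      if (decide (x.2.val % 2 = 1) == decide (x.1 < (doubledGrinberg x).1)) then 0 else 1)

theorem edgeConn_doubledGrinberg (D : Finset (Fin 46 × Fin 5)) (hD : D.card < 5)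
    (Q : Fin 46 → Prop) (hQ : ∀ p ∉ D, Q p.1 → Q (doubledGrinberg p).1) (u v : Fin 46)
    (hu : Q u) : Q v := by
  classical
  by_contra hv
  have h1 := lt_weight_cut (t := 1) (lim := 4) (wt := fun k => if k = 0 then 1 else 2)
    isDartMap_grinberg.invol tableHead_grinberg (by decide +kernel) (by decide +kernel)
    (Finset.univ.filter Q) (Finset.card_pos.2 ⟨u, by simpa using hu⟩)
    (Finset.card_pos.2 ⟨v, by simpa using hv⟩)
  have h3 : ∑ x with x.1 ∈ Finset.univ.filter Q ∧ (grinberg x).1 ∉ Finset.univ.filter Q,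
      (if (x.2 : ℕ) = 0 then 1 else 2) =
      (Finset.univ.filter fun x => x.1 ∈ Finset.univ.filter Q ∧
        (doubledGrinberg x).1 ∉ Finset.univ.filter Q).card := by
    rw [Finset.sum_filter, Fintype.sum_prod_type, Finset.card_filter, Fintype.sum_prod_type]
    refine Finset.sum_congr rfl fun w _ => ?_
    rw [Fin.sum_univ_three, Fin.sum_univ_five]
    have e : ∀ i, (doubledGrinberg (w, i)).1 = (grinberg (w, undouble i)).1 := fun _ => rfl
    simp only [e, show undouble 0 = 0 from rfl, show undouble 1 = 1 from rfl,
      show undouble 2 = 1 from rfl, show undouble 3 = 2 from rfl, show undouble 4 = 2 from rfl]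
    split_ifs <;> simp_all
  have h2 : (Finset.univ.filter fun x => x.1 ∈ Finset.univ.filter Q ∧
      (doubledGrinberg x).1 ∉ Finset.univ.filter Q) ⊆ D := by
    intro x hx
    simp only [Finset.mem_filter, Finset.mem_univ, true_and] at hx
    by_contra hxD
    exact hx.2 (hQ x hxD hx.1)
  have h4 := Finset.card_le_card h2
  omega

/-- If the matchings use parallel edges, or the same edge, at `w`, the two ends form a closed set.
Otherwise the third darts form a perfect matching of the cubic graph, to which
`exists_proper_closed` applies. -/
theorem noPair_doubledGrinberg (j j' : Fin 46 → Fin 5)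
    (hj : ∀ w, (doubledGrinberg (w, j w)).2 = j (doubledGrinberg (w, j w)).1)
    (hj' : ∀ w, (doubledGrinberg (w, j' w)).2 = j' (doubledGrinberg (w, j' w)).1) :
    ∃ Q : Fin 46 → Prop, (∃ w, Q w) ∧ (∃ w, ¬ Q w) ∧
      ∀ w, Q w → Q (doubledGrinberg (w, j w)).1 ∧ Q (doubledGrinberg (w, j' w)).1 := by
  have hback : ∀ j : Fin 46 → Fin 5,
      (∀ w, (doubledGrinberg (w, j w)).2 = j (doubledGrinberg (w, j w)).1) →
      ∀ w, doubledGrinberg ((doubledGrinberg (w, j w)).1, j (doubledGrinberg (w, j w)).1) =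
        (w, j w) := fun j hj w => by
    rw [← hj, Prod.mk.eta, doubledGrinberg_invol]
  by_cases h : ∃ w, undouble (j w) = undouble (j' w)
  · obtain ⟨w, hw⟩ := h
    have hww : (doubledGrinberg (w, j' w)).1 = (doubledGrinberg (w, j w)).1 := by
      simp only [doubledGrinberg, hw]
    have h1 := hback j hj w
    have h2 := hback j' hj' w
    rw [hww] at h2
    obtain ⟨z, hz1, hz2⟩ : ∃ z : Fin 46, z ≠ w ∧ z ≠ (doubledGrinberg (w, j w)).1 := by
      by_contra! hz
      have e0 := hz 0
      have e1 := hz 1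
      have e2 := hz 2
      omega
    refine ⟨fun z => z = w ∨ z = (doubledGrinberg (w, j w)).1, ⟨w, Or.inl rfl⟩,
      ⟨z, not_or.2 ⟨hz1, hz2⟩⟩, ?_⟩
    rintro x (rfl | rfl)
    · exact ⟨Or.inr rfl, Or.inr hww⟩
    · exact ⟨Or.inl (congrArg Prod.fst h1), Or.inl (congrArg Prod.fst h2)⟩
  · push Not at h
    -- As `0 + 1 + 2 = 0` in `Fin 3`, the third index is minus the sum of the other two.
    have hthird : ∀ a b k : Fin 3, a ≠ b → (k = -(a + b) ↔ k ≠ a ∧ k ≠ b) := by decide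
    have key : ∀ j : Fin 46 → Fin 5,
        (∀ w, (doubledGrinberg (w, j w)).2 = j (doubledGrinberg (w, j w)).1) →
        ∀ w k, k ≠ undouble (j w) →
          (grinberg (w, k)).2 ≠ undouble (j (grinberg (w, k)).1) := by
      intro j hj w k hk h'
      have h1 : (doubledGrinberg ((grinberg (w, k)).1, j (grinberg (w, k)).1)).1 = w := by
        simp only [doubledGrinberg, ← h', Prod.mk.eta, isDartMap_grinberg.invol]
      have h2 := hj (grinberg (w, k)).1
      have h3 := undouble_doubledGrinberg ((grinberg (w, k)).1, j (grinberg (w, k)).1)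
      simp only [← h', Prod.mk.eta, isDartMap_grinberg.invol] at h3
      rw [h2, h1] at h3
      exact hk h3.symm
    obtain ⟨Q, h1, h2, hQ⟩ := exists_proper_closed
      (fun w => -(undouble (j w) + undouble (j' w))) fun w => by
        have h1 := (hthird _ _ _ (h w)).1 rfl
        exact (hthird _ _ _ (h _)).2 ⟨key j hj w _ h1.1, key j' hj' w _ h1.2⟩
    refine ⟨Q, h1, h2, fun w hw => ⟨hQ (w, undouble (j w)) ?_ hw, hQ (w, undouble (j' w)) ?_ hw⟩⟩
    · exact fun h' => ((hthird _ _ _ (h w)).1 h').1 rfl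
    · exact fun h' => ((hthird _ _ _ (h w)).1 h').2 rfl

theorem isFrame_doubledGrinberg : IsFrame doubledGrinberg where
  invol := doubledGrinberg_invol
  loopless := fun p => isDartMap_grinberg.loopless (p.1, undouble p.2)
  euler := by
    -- 71 counts the 25 faces of Grinberg's graph and the 46 digons; the longest face has length 9,
    -- whence `n = 8`.
    rw [card_orbits_eq (key := fun x => 5 * x.1.val + x.2.val) (n := 8) (k := 71)
      (by decide +kernel) (by decide +kernel), Fintype.card_fin]
  colour := by
    refine ⟨doubledColouring, ?_, ?_⟩
    · decide +kernel
    · unfold Function.Injective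
      decide +kernel
  edgeConn := edgeConn_doubledGrinberg
  vertexConn := by
    intro w₀ Q hQ u v hu hv
    refine noSeparator_grinberg {w₀} Q (by simp) ?_ u v (by simpa using hu) (by simpa using hv)
    rintro ⟨w, k⟩ h1 h2
    obtain ⟨i, rfl⟩ := exists_undouble k
    exact hQ (w, i) (by simpa using h1) (fun h => h2 (Finset.mem_singleton.2 h))
  noPair := fun j j' hj hj' _ => noPair_doubledGrinberg j j' hj hj'

theorem encard_doubledGrinberg (w w' : Fin 46) :
    {i | (doubledGrinberg (w, i)).1 = w'}.encard =
      doubledOutside (dartGraph grinberg isDartMap_grinberg)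
        (colourClass isDartMap_grinberg isDartColouring_grinberg 0) w w' := by
  have h : ∀ w w', (Finset.univ.filter fun i => (doubledGrinberg (w, i)).1 = w').card =
      if ∃ i, (grinberg (w, i)).1 = w' ∧ grinbergColouring (w, i) = 0 then 1
      else if ∃ i, (grinberg (w, i)).1 = w' then 2 else 0 := by
    decide +kernel
  have h1 : {i | (doubledGrinberg (w, i)).1 = w'} =
      ((Finset.univ.filter fun i => (doubledGrinberg (w, i)).1 = w' : Finset (Fin 5)) : Set _) := by
    ext i
    simp
  rw [h1, Set.encard_coe_eq_coe_finsetCard, h, doubledOutside]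
  congr

end Doubled

/-! ### The infinite family. -/

/-- A quintic plane graph on `Fin n` that can be substituted into a frame. -/
structure QuinticMap where
  n : ℕ
  r : Fin n × Fin 5 → Fin n × Fin 5
  g : Fin n
  a : Fin n
  isQuintic : IsQuintic r g a

namespace QuinticMap

/-- The graph of a quintic map. -/
def graph (G : QuinticMap) : SimpleGraph (Fin G.n) :=
  dartGraph G.r G.isQuintic.toIsDartMap

/-- A numbering of the vertices of the substitution into the doubled Grinberg graph. -/
noncomputable def vertexEquiv (G : QuinticMap) :
    Fin 46 × {x : Fin G.n // x ≠ G.g} ≃ Fin (Fintype.card (Fin 46 × {x : Fin G.n // x ≠ G.g})) :=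
  Fintype.equivFin _

/-- The substitution of a quintic map into the doubled Grinberg graph. -/
noncomputable def next (G : QuinticMap) : QuinticMap where
  n := Fintype.card (Fin 46 × {x : Fin G.n // x ≠ G.g})
  r := relabel G.vertexEquiv (substitute G.isQuintic.toIsDartMap G.g doubledGrinberg)
  g := G.vertexEquiv (0, ⟨G.a, G.isQuintic.ne⟩)
  a := G.vertexEquiv (1, ⟨G.a, G.isQuintic.ne⟩)
  isQuintic := (G.isQuintic.substitute isFrame_doubledGrinberg (by decide)).relabel G.vertexEquiv

theorem n_lt_next (G : QuinticMap) : G.n < G.next.n := by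
  have h := G.isQuintic.large
  rw [Fintype.card_fin] at h
  change G.n < Fintype.card (Fin 46 × {x : Fin G.n // x ≠ G.g})
  rw [Fintype.card_prod, Fintype.card_subtype_compl, Fintype.card_subtype_eq, Fintype.card_fin,
    Fintype.card_fin]
  omega

/-- Iterated substitution, starting from the icosahedron. -/
noncomputable def chain : ℕ → QuinticMap
  | 0 => ⟨12, icosahedron, 0, 11, isQuintic_icosahedron⟩
  | i + 1 => (chain i).next

theorem strictMono_chain : StrictMono fun i => (chain i).n :=
  strictMono_nat_of_lt_succ fun i => (chain i).n_lt_next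

end QuinticMap

end PerfectPairs

theorem mainTheorem4 :
    -- a non-hamiltonian planar cubic graph `H`, a 1-factorisation of it, and one of its factors
    ∃ (h : ℕ) (H : SimpleGraph (Fin h)) (𝓗 : Set H.Subgraph) (F : H.Subgraph),
      PerfectPairs.IsPlanar H ∧
      PerfectPairs.IsRegular H 3 ∧
      PerfectPairs.IsKConnected H 3 ∧
      PerfectPairs.IsCyclicallyKEdgeConnected H 5 ∧
      ¬ H.IsHamiltonian ∧
      PerfectPairs.IsOneFactorisation H 𝓗 ∧ F ∈ 𝓗 ∧
      -- an infinite family of pairwise non-isomorphic graphs `Γ i`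
      ∃ (N : ℕ → ℕ) (Γ : (i : ℕ) → SimpleGraph (Fin (N i))),
        (∀ i j : ℕ, i ≠ j → IsEmpty (Γ i ≃g Γ j)) ∧
        ∀ i : ℕ,
          PerfectPairs.IsPlanar (Γ i) ∧
          PerfectPairs.IsKConnected (Γ i) 5 ∧
          PerfectPairs.IsRegular (Γ i) 5 ∧
          (∃ 𝓕 : Set (Γ i).Subgraph, PerfectPairs.IsOneFactorisation (Γ i) 𝓕) ∧
          (∀ 𝓕 : Set (Γ i).Subgraph, PerfectPairs.IsOneFactorisation (Γ i) 𝓕 →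
            ∀ M ∈ 𝓕, ∀ M' ∈ 𝓕, ¬ PerfectPairs.IsPerfectPair M M') ∧
          -- `Γ i` arises by substituting copies of some `G - g` for the vertices of doubled `H`
          ∃ (n : ℕ) (G : SimpleGraph (Fin n)) (g : Fin n),
            PerfectPairs.IsPlanar G ∧
            PerfectPairs.IsKConnected G 5 ∧
            PerfectPairs.IsRegular G 5 ∧
            (∃ 𝓖 : Set G.Subgraph, PerfectPairs.IsOneFactorisation G 𝓖) ∧
            PerfectPairs.IsSubstitution (PerfectPairs.doubledOutside H F) G g (Γ i) := by
  open PerfectPairs in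
  refine ⟨46, dartGraph grinberg isDartMap_grinberg,
    Set.range (colourClass isDartMap_grinberg isDartColouring_grinberg),
    colourClass isDartMap_grinberg isDartColouring_grinberg 0, isPlanar_grinberg,
    isRegular_dartGraph _, isKConnected_dartGraph _ (by simp) noSeparator_grinberg,
    isCyclicallyKEdgeConnected_grinberg, not_isHamiltonian_grinberg,
    isOneFactorisation_colourClass _ _, ⟨0, rfl⟩,
    -- The shift omits the icosahedron, so every member is a substitution of its predecessor in the
    -- chain.
    fun i => (QuinticMap.chain (i + 1)).n, fun i => (QuinticMap.chain (i + 1)).graph,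
    fun i j hij => ⟨fun f => hij ?_⟩, fun i => ?_⟩
  · exact Nat.succ_injective (QuinticMap.strictMono_chain.injective
      (Fin.equiv_iff_eq.1 ⟨f.toEquiv⟩))
  · have h := (QuinticMap.chain i).isQuintic
    have h' := (QuinticMap.chain (i + 1)).isQuintic
    refine ⟨h'.isPlanar, h'.isKConnected, isRegular_dartGraph _, h'.exists_isOneFactorisation,
      fun 𝓕 h𝓕 M hM M' hM' =>
        isFrame_doubledGrinberg.not_isPerfectPair h (QuinticMap.chain i).vertexEquiv _ h𝓕 hM hM',
      (QuinticMap.chain i).n, (QuinticMap.chain i).graph, (QuinticMap.chain i).g, h.isPlanar,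
      h.isKConnected, isRegular_dartGraph _, h.exists_isOneFactorisation,
      isFrame_doubledGrinberg.isSubstitution h (QuinticMap.chain i).vertexEquiv _
        fun w w' _ => encard_doubledGrinberg w w'⟩
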